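/- **Definitions.** Let $n\ge 0$, $N\ge 1$. Write $\mathfrak h_n$ for the space of symmetric complex $n\times n$ matrices $Z$ with $\mathrm{Im}\,Z>0$, on which $\gamma=\begin{pmatrix}A&B\\C&D\end{pmatrix}\in \mathbf{Sp}(2n,\mathbb Z)$ acts by $\gamma\cdot Z=(AZ+B)(CZ+D)^{-1}$. Put $\tau(Z)=-\overline Z$ and $\tau(\gamma)=I_-\gamma I_-$ with $I_-=\mathrm{diag}(-I_n,I_n)$, and let $\Gamma(N)=\{\gamma\in\mathbf{Sp}(2n,\mathbb Z):\gamma\equiv I \bmod N\}$, on which $\mathrm{Gal}(\mathbb C/\mathbb R)$ acts with complex conjugation acting as $\tau$. For $\gamma\in\Gamma(N)$ let $f_\gamma:\mathrm{Gal}(\mathbb C/\mathbb R)\to\Gamma(N)$ be the map with $f_\gamma(1)=I$ and $f_\gamma(\text{conjugation})=\gamma$. It is a 1-cocycle iff $\gamma\,\tau(\gamma)=I$, and $[f_\gamma]=[f_{\gamma'}]$ in the nonabelian cohomology set $H^1(\mathbb C/\mathbb R,\Gamma(N))$ iff $\gamma'=\tau(h)\gamma h^{-1}$ for some $h\in\Gamma(N)$.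 A *real principally polarized abelian variety with level $N$ structure* (of dimension $n$) is a quadruple $\mathcal A=(\mathbb C^n/L,\,H,\,\kappa,\,\{U_i,V_j\})$ where: $L\subset\mathbb C^n$ is a lattice; $H=R+iQ$ is a positive definite Hermitian form (linear in the first variable) such that $L$ has a symplectic basis, i.e. a $\mathbb Z$-basis $\{u_i,v_j\}_{1\le i,j\le n}$ in which $Q$ has matrix $\begin{pmatrix}0&I\\-I&0\end{pmatrix}$; $\kappa:\mathbb C^n\to\mathbb C^n$ is an antilinear involution with $\kappa(L)=L$ and $Q(\kappa u,\kappa v)=-Q(u,v)$; and $\{U_i,V_j\}$ is a basis of the $N$-torsion points of $\mathbb C^n/L$ which has a lift, i.e. a symplectic basis $\{u_i,v_j\}$ of $L$ with $U_i\equiv u_i/N$, $V_j\equiv v_j/N \pmod L$, and for every (equivalently, some) lift $\kappa(u_i/N)\equiv -u_i/N$ and $\kappa(v_j/N)\equiv v_j/N\pmod L$. An *isomorphism* $\mathcal A\to\mathcal A'$ is a complex linear isomorphism $\phi$ of $\mathbb C^n$ with $\phi(L)=L'$, $H'(\phi u,\phi v)=H(u,v)$ and $\phi\kappa\phi^{-1}=\kappa'$,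 whose induced map $\mathbb C^n/L\to\mathbb C^n/L'$ sends $U_i\mapsto U_i'$ and $V_j\mapsto V_j'$. For $Z\in\mathfrak h_n$ and $\gamma=\begin{pmatrix}A&B\\C&D\end{pmatrix}\in\Gamma(N)$ with $\gamma\cdot Z=\tau(Z)$, let $F_Z(x,y)=Zx+y$ for $x,y\in\mathbb R^n$, let $\{e_i,f_j\}$ be the standard basis of $\mathbb R^n\oplus\mathbb R^n$, and put $L_Z=F_Z(\mathbb Z^n\oplus\mathbb Z^n)$, $H_Z(u,v)={}^tu\,(\mathrm{Im}\,Z)^{-1}\bar v$, $\kappa(\gamma,Z)(M)={}^t(CZ+D)\overline M$, and $$\mathcal A_Z=\bigl(\mathbb C^n/L_Z,\;H_Z,\;\kappa(\gamma,Z),\;\{F_Z(e_i/N),\,F_Z(f_j/N)\}\bigr).$$ **Proposition.** Let $N\ge 3$. 1. For every real principally polarized abelian variety $\mathcal A$ with level $N$ structure there exist $Z\in\mathfrak h_n$ and $\gamma\in\Gamma(N)$ with $\gamma\cdot Z=\tau(Z)$ such that $\gamma$ is the only element of $\Gamma(N)$ with this property for $Z$ (so that $\mathcal A_Z$ is determined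 by $Z$), $\mathcal A_Z$ is a real principally polarized abelian variety with level $N$ structure, and there is an isomorphism $\mathcal A_Z\to\mathcal A$ of real principally polarized abelian varieties with level $N$ structure. 2. If $N=4m$ with $m\ge 1$, the class $[f_\gamma]$ is uniquely determined by the isomorphism class of $\mathcal A$: if $\mathcal A\cong\mathcal A'$, and if $(Z,\gamma)$ and $(Z',\gamma')$ are any pairs as in part 1 (that is, $\gamma,\gamma'\in\Gamma(4m)$, $\gamma\cdot Z=\tau(Z)$, $\gamma'\cdot Z'=\tau(Z')$) with $\mathcal A_Z\cong\mathcal A$ and $\mathcal A_{Z'}\cong\mathcal A'$, then $f_\gamma$ and $f_{\gamma'}$ are 1-cocycles and $[f_\gamma]=[f_{\gamma'}]$ in $H^1(\mathbb C/\mathbb R,\Gamma(4m))$. -/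

import Mathlib

open Matrix

noncomputable section

namespace RealAbVar

/-! ### The symplectic group, its congruence subgroups and the involution `τ` -/

/-- The group `Sp(2n, ℤ)`. -/
abbrev SpZ (n : ℕ) : Type := symplecticGroup (Fin n) ℤ

/-- The matrix `I₋ = diag(-I, I)`. -/
def Iminus (n : ℕ) : Matrix (Fin n ⊕ Fin n) (Fin n ⊕ Fin n) ℤ :=
  fromBlocks (-1) 0 0 1

theorem Iminus_mul_self (n : ℕ) : Iminus n * Iminus n = 1 := by
  simp [Iminus, fromBlocks_multiply]

theorem Iminus_mul_mul_mem (n : ℕ) {g : Matrix (Fin n ⊕ Fin n) (Fin n ⊕ Fin n) ℤ}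
    (hg : g ∈ symplecticGroup (Fin n) ℤ) :
    Iminus n * g * Iminus n ∈ symplecticGroup (Fin n) ℤ := by
  rw [SymplecticGroup.mem_iff] at hg ⊢
  have hT : (Iminus n)ᵀ = Iminus n := by simp [Iminus, fromBlocks_transpose]
  have hJ : Iminus n * J (Fin n) ℤ * Iminus n = -J (Fin n) ℤ := by
    simp [Iminus, J, fromBlocks_multiply, fromBlocks_neg]
  calc Iminus n * g * Iminus n * J (Fin n) ℤ * (Iminus n * g * Iminus n)ᵀ
      = Iminus n * g * (Iminus n * J (Fin n) ℤ * Iminus n) * gᵀ * Iminus n := by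
        simp only [transpose_mul, hT, Matrix.mul_assoc]
    _ = -(Iminus n * (g * J (Fin n) ℤ * gᵀ) * Iminus n) := by
        rw [hJ]; simp only [Matrix.mul_assoc, Matrix.mul_neg, Matrix.neg_mul]
    _ = J (Fin n) ℤ := by rw [hg, hJ, neg_neg]

/-- The involution `τ(g) = I₋ g I₋` of `Sp(2n, ℤ)`. -/
def tauSp (n : ℕ) : SpZ n →* SpZ n where
  toFun g := ⟨Iminus n * g.1 * Iminus n, Iminus_mul_mul_mem n g.2⟩
  map_one' := by
    ext1
    simp [Iminus_mul_self]
  map_mul' g h := by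
    ext1
    calc Iminus n * (g.1 * h.1) * Iminus n
        = Iminus n * g.1 * 1 * h.1 * Iminus n := by simp only [Matrix.mul_assoc, Matrix.mul_one]
      _ = Iminus n * g.1 * Iminus n * (Iminus n * h.1 * Iminus n) := by
        rw [← Iminus_mul_self]; simp only [Matrix.mul_assoc]

theorem tauSp_tauSp (n : ℕ) (g : SpZ n) : tauSp n (tauSp n g) = g := by
  ext1
  change Iminus n * (Iminus n * g.1 * Iminus n) * Iminus n = g.1
  calc Iminus n * (Iminus n * g.1 * Iminus n) * Iminus n
      = (Iminus n * Iminus n) * g.1 * (Iminus n * Iminus n) := by simp only [Matrix.mul_assoc]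
    _ = g.1 := by simp [Iminus_mul_self]

/-- Reduction modulo `N` of a square integral matrix. -/
abbrev redMod (n N : ℕ) : Matrix (Fin n ⊕ Fin n) (Fin n ⊕ Fin n) ℤ →+*
    Matrix (Fin n ⊕ Fin n) (Fin n ⊕ Fin n) (ZMod N) :=
  (Int.castRingHom (ZMod N)).mapMatrix

/-- The principal congruence subgroup `Γ(N)` of `Sp(2n, ℤ)`: the `γ ≡ I (mod N)`. -/
def Gam (n N : ℕ) : Subgroup (SpZ n) where
  carrier := {g | redMod n N g.1 = 1}
  one_mem' := map_one (redMod n N)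
  mul_mem' {g h} hg hh := by
    change redMod n N (g.1 * h.1) = 1
    rw [map_mul, show redMod n N g.1 = 1 from hg, show redMod n N h.1 = 1 from hh, mul_one]
  inv_mem' {g} hg := by
    change redMod n N (g⁻¹ : SpZ n).1 = 1
    have h1 : (g⁻¹ : SpZ n).1 * g.1 = 1 := congrArg Subtype.val (inv_mul_cancel g)
    have h2 := congrArg (redMod n N) h1
    rwa [map_mul, show redMod n N g.1 = 1 from hg, mul_one, map_one] at h2

theorem tauSp_mem_Gam {n N : ℕ} {g : SpZ n} (hg : g ∈ Gam n N) : tauSp n g ∈ Gam n N := by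
  change redMod n N (Iminus n * g.1 * Iminus n) = 1
  rw [map_mul, map_mul, show redMod n N g.1 = 1 from hg, mul_one, ← map_mul, Iminus_mul_self,
    map_one]

/-- The restriction of `τ` to `Γ(N)`. -/
def tauGam (n N : ℕ) : Gam n N →* Gam n N :=
  ((tauSp n).comp (Gam n N).subtype).codRestrict (Gam n N) fun g => tauSp_mem_Gam g.2

theorem tauGam_tauGam (n N : ℕ) (g : Gam n N) : tauGam n N (tauGam n N g) = g :=
  Subtype.ext (tauSp_tauSp n g.1)

/-! ### Nonabelian Galois cohomology `H¹(ℂ/ℝ, M)` -/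

/-- The group `Gal(ℂ/ℝ)`. -/
abbrev GalCR : Type := ℂ ≃ₐ[ℝ] ℂ

theorem galCR_eq_of_ne_one {s t : GalCR} (hs : s ≠ 1) (ht : t ≠ 1) : s = t := by
  have key : ∀ u : GalCR, u ≠ 1 → u = Complex.conjAe := by
    intro u hu
    rcases Complex.real_algHom_eq_id_or_conj u.toAlgHom with h | h
    · exact absurd (AlgEquiv.ext fun z => DFunLike.congr_fun h z) hu
    · exact AlgEquiv.ext fun z => DFunLike.congr_fun h z
  rw [key s hs, key t ht]

open Classical in
/-- `Gal(ℂ/ℝ)` acts on `Γ(N)`, its nontrivial element acting by `τ`. -/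
instance galAction (n N : ℕ) : MulDistribMulAction GalCR (Gam n N) where
  smul s g := if s = 1 then g else tauGam n N g
  one_smul g := if_pos rfl
  mul_smul s t g := by
    change (if s * t = 1 then g else tauGam n N g) =
      if s = 1 then (if t = 1 then g else tauGam n N g)
        else tauGam n N (if t = 1 then g else tauGam n N g)
    by_cases hs : s = 1
    · simp [hs]
    by_cases ht : t = 1
    · simp [hs, ht]
    have hst : s * t = 1 := by
      have : s⁻¹ = t := galCR_eq_of_ne_one (by simpa using hs) ht
      rw [← this, mul_inv_cancel]
    simp [hs, ht, hst, tauGam_tauGam]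
  smul_one s := by
    change (if s = 1 then 1 else tauGam n N 1) = 1
    simp
  smul_mul s g h := by
    change (if s = 1 then g * h else tauGam n N (g * h)) =
      (if s = 1 then g else tauGam n N g) * (if s = 1 then h else tauGam n N h)
    split_ifs
    · rfl
    · exact map_mul _ _ _

section H1

variable (S M : Type*) [Group S] [Group M] [MulDistribMulAction S M]

/-- 1-cocycles of a group `S` with values in a (nonabelian) `S`-group `M`. -/
def IsCocycle (f : S → M) : Prop := ∀ s t : S, f (s * t) = f s * s • f t

/-- Cohomologous cocycles: `f' s = a⁻¹ · f s · (s • a)` for some `a ∈ M`. -/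
def cohomologous : Setoid {f : S → M // IsCocycle S M f} where
  r f f' := ∃ a : M, ∀ s : S, f'.1 s = a⁻¹ * f.1 s * s • a
  iseqv :=
    { refl := fun f => ⟨1, fun s => by simp⟩
      symm := by
        rintro f f' ⟨a, ha⟩
        refine ⟨a⁻¹, fun s => ?_⟩
        rw [ha s, smul_inv']
        group
      trans := by
        rintro f f' f'' ⟨a, ha⟩ ⟨b, hb⟩
        refine ⟨a * b, fun s => ?_⟩
        rw [hb s, ha s, smul_mul']
        group }

/-- The nonabelian cohomology set `H¹(S, M)`. -/
def H1 : Type _ := Quotient (cohomologous S M)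

variable {S M}

/-- The cohomology class of a cocycle. -/
def H1.mk (f : S → M) (hf : IsCocycle S M f) : H1 S M := Quotient.mk (cohomologous S M) ⟨f, hf⟩

end H1

open Classical in
/-- The map `f_γ : Gal(ℂ/ℝ) → Γ(N)` with `f_γ(1) = I` and `f_γ(conjugation) = γ`. -/
def fcoc {n N : ℕ} (γ : Gam n N) : GalCR → Gam n N := fun s => if s = 1 then 1 else γ

/-! ### The Siegel space -/

/-- The Siegel upper half space `𝔥ₙ`. -/
structure Siegel (n : ℕ) where
  mat : Matrix (Fin n) (Fin n) ℂ
  symm : matᵀ = mat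
  im_pos : (mat.map Complex.im).PosDef

/-- The antiholomorphic involution `τ(Z) = -Z̄` of `𝔥ₙ`. -/
def tauH {n : ℕ} (Z : Siegel n) : Siegel n where
  mat := -(Z.mat.map (starRingEnd ℂ))
  symm := by rw [transpose_neg, ← transpose_map, Z.symm]
  im_pos := by
    have : (-(Z.mat.map (starRingEnd ℂ))).map Complex.im = Z.mat.map Complex.im := by
      ext i j; simp
    rw [this]
    exact Z.im_pos

/-- The block `A` of `γ = (A B; C D)`, as a complex matrix. -/
def blkA {n : ℕ} (γ : SpZ n) : Matrix (Fin n) (Fin n) ℂ := γ.1.toBlocks₁₁.map (Int.cast : ℤ → ℂ)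
/-- The block `B`, as a complex matrix. -/
def blkB {n : ℕ} (γ : SpZ n) : Matrix (Fin n) (Fin n) ℂ := γ.1.toBlocks₁₂.map (Int.cast : ℤ → ℂ)
/-- The block `C`, as a complex matrix. -/
def blkC {n : ℕ} (γ : SpZ n) : Matrix (Fin n) (Fin n) ℂ := γ.1.toBlocks₂₁.map (Int.cast : ℤ → ℂ)
/-- The block `D`, as a complex matrix. -/
def blkD {n : ℕ} (γ : SpZ n) : Matrix (Fin n) (Fin n) ℂ := γ.1.toBlocks₂₂.map (Int.cast : ℤ → ℂ)

/-- The fractional linear action `γ · Z = (AZ + B)(CZ + D)⁻¹` on points `Z` of `𝔥ₙ`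
(for which `CZ + D` is always invertible). -/
def act {n : ℕ} (γ : SpZ n) (Z : Siegel n) : Matrix (Fin n) (Fin n) ℂ :=
  (blkA γ * Z.mat + blkB γ) * (blkC γ * Z.mat + blkD γ)⁻¹

/-- `Z` is a `γ`-real point: `γ · Z = τ(Z)`. -/
def IsRealPoint {n : ℕ} (γ : SpZ n) (Z : Siegel n) : Prop := act γ Z = (tauH Z).mat

/-! ### Real principally polarized abelian varieties with level structure -/

/-- The space `ℂⁿ`. -/
abbrev Cn (n : ℕ) : Type := Fin n → ℂ

/-- The data of a quadruple `(A = ℂⁿ/L, H, κ, {Uᵢ, Vⱼ})`, before any condition is imposed: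
a subgroup `L` of `ℂⁿ`, a sesquilinear form `H` (linear in the first variable), an antilinear
map `κ`, and points `Uᵢ = lev (inl i)`, `Vⱼ = lev (inr j)` of `ℂⁿ/L`. -/
structure Quad (n : ℕ) where
  L : Submodule ℤ (Cn n)
  H : Cn n →ₗ[ℂ] Cn n →ₗ⋆[ℂ] ℂ
  κ : Cn n →ₗ⋆[ℂ] Cn n
  lev : Fin n ⊕ Fin n → Cn n ⧸ L

namespace Quad

variable {n : ℕ}

/-- `Q = Im H`. -/
def Q (A : Quad n) (u v : Cn n) : ℝ := (A.H u v).im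

/-- The basis `b` of `L` (with `uᵢ = b (inl i)`, `vⱼ = b (inr j)`) is symplectic: the matrix of
`Q` in this basis is `(0 I; -I 0)`. -/
def IsSymplecticBasis (A : Quad n) (b : Module.Basis (Fin n ⊕ Fin n) ℤ A.L) : Prop :=
  (Matrix.of fun i j => A.Q (b i) (b j)) = fromBlocks 0 1 (-1) 0

/-- The symplectic basis `b` is a lift of the level `N` structure: `Uᵢ ≡ uᵢ/N` and `Vⱼ ≡ vⱼ/N`
modulo `L`. -/
def IsLift (N : ℕ) (A : Quad n) (b : Module.Basis (Fin n ⊕ Fin n) ℤ A.L) : Prop :=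
  A.IsSymplecticBasis b ∧ ∀ i, A.lev i = A.L.mkQ ((N : ℂ)⁻¹ • (b i : Cn n))

/-- The quadruple is a real principally polarized abelian variety with level `N` structure. -/
structure IsRealPPAV (N : ℕ) (A : Quad n) : Prop where
  /-- `L` is a lattice in `ℂⁿ` -/
  discrete : DiscreteTopology A.L
  span_top : Submodule.span ℝ (A.L : Set (Cn n)) = ⊤
  /-- `H` is a positive definite Hermitian form -/
  hermitian : ∀ u v, A.H v u = starRingEnd ℂ (A.H u v)
  pos : ∀ u, u ≠ 0 → 0 < (A.H u u).re
  /-- `L` is symplectic, and `lev` is a level `N` structure (being the reduction of `b/N` for a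
  basis `b` of `L`, it is a basis of the `N`-torsion points of `ℂⁿ/L`) -/
  level : ∃ b, A.IsLift N b
  /-- `κ` is a real structure -/
  invol : ∀ u, A.κ (A.κ u) = u
  map_lattice : A.κ '' (A.L : Set (Cn n)) = A.L
  /-- `κ` is compatible with the polarization -/
  compat : ∀ u v, A.Q (A.κ u) (A.κ v) = -A.Q u v
  /-- the level structure is compatible with `κ` -/
  level_compat : ∀ b, A.IsLift N b →
    (∀ i, A.L.mkQ (A.κ ((N : ℂ)⁻¹ • (b (Sum.inl i) : Cn n))) =
      A.L.mkQ (-((N : ℂ)⁻¹ • (b (Sum.inl i) : Cn n)))) ∧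
    (∀ j, A.L.mkQ (A.κ ((N : ℂ)⁻¹ • (b (Sum.inr j) : Cn n))) =
      A.L.mkQ ((N : ℂ)⁻¹ • (b (Sum.inr j) : Cn n)))

/-- `φ` is an isomorphism of quadruples. -/
structure IsIso (A A' : Quad n) (φ : Cn n ≃ₗ[ℂ] Cn n) : Prop where
  map_lattice : φ '' (A.L : Set (Cn n)) = A'.L
  map_form : ∀ u v, A'.H (φ u) (φ v) = A.H u v
  map_real : ∀ u, φ (A.κ u) = A'.κ (φ u)
  /-- the induced map `ℂⁿ/L → ℂⁿ/L'` carries one level structure to the other -/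
  map_level : ∀ i x, A.L.mkQ x = A.lev i → A'.L.mkQ (φ x) = A'.lev i

/-- The quadruples are isomorphic. -/
def Isomorphic (A A' : Quad n) : Prop := ∃ φ, IsIso A A' φ

end Quad

/-! ### The standard quadruple `𝒜_Z` -/

/-- The real linear map `F_Z(x, y) = Zx + y` from `ℝⁿ ⊕ ℝⁿ` to `ℂⁿ`. -/
def FZ {n : ℕ} (Z : Siegel n) : (Fin n ⊕ Fin n → ℝ) →ₗ[ℝ] Cn n where
  toFun w := Z.mat *ᵥ (fun i => (w (Sum.inl i) : ℂ)) + fun j => (w (Sum.inr j) : ℂ)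
  map_add' v w := by
    ext i
    simp only [Pi.add_apply, Complex.ofReal_add, Matrix.mulVec, dotProduct, mul_add,
      Finset.sum_add_distrib]
    ring
  map_smul' c v := by
    ext i
    simp only [Pi.add_apply, Pi.smul_apply, smul_eq_mul, Complex.ofReal_mul, Matrix.mulVec,
      dotProduct, RingHom.id_apply, Complex.real_smul, mul_add, Finset.mul_sum]
    congr 1
    exact Finset.sum_congr rfl fun j _ => by ring

/-- The lattice `L_Z = F_Z(ℤⁿ ⊕ ℤⁿ)`. -/
def LZ {n : ℕ} (Z : Siegel n) : Submodule ℤ (Cn n) :=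
  Submodule.span ℤ (Set.range fun i : Fin n ⊕ Fin n => FZ Z (Pi.single i 1))

/-- The Hermitian form `H_Z(u, v) = ᵗu (Im Z)⁻¹ v̄`. -/
def HZ {n : ℕ} (Z : Siegel n) : Cn n →ₗ[ℂ] Cn n →ₗ⋆[ℂ] ℂ :=
  LinearMap.mk₂'ₛₗ (RingHom.id ℂ) (starRingEnd ℂ)
    (fun u v => u ⬝ᵥ ((Z.mat.map Complex.im)⁻¹.map (Complex.ofReal)) *ᵥ (star v))
    (fun u u' v => by rw [add_dotProduct])
    (fun c u v => by rw [smul_dotProduct]; rfl)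
    (fun u v v' => by rw [star_add, mulVec_add, dotProduct_add])
    (fun c u v => by rw [star_smul, mulVec_smul, dotProduct_smul]; rfl)

/-- The map `κ(γ, Z) : M ↦ ᵗ(CZ + D) M̄`. -/
def kappaZ {n : ℕ} (γ : SpZ n) (Z : Siegel n) : Cn n →ₗ⋆[ℂ] Cn n where
  toFun M := (blkC γ * Z.mat + blkD γ)ᵀ *ᵥ (star M)
  map_add' M M' := by rw [star_add, mulVec_add]
  map_smul' c M := by rw [star_smul, mulVec_smul]; rfl

/-- The quadruple `𝒜_Z = (ℂⁿ/L_Z, H_Z, κ(γ, Z), {F_Z(eᵢ/N), F_Z(fⱼ/N)})`. -/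
def stdQuad {n : ℕ} (N : ℕ) (γ : SpZ n) (Z : Siegel n) : Quad n where
  L := LZ Z
  H := HZ Z
  κ := kappaZ γ Z
  lev i := (LZ Z).mkQ ((N : ℂ)⁻¹ • FZ Z (Pi.single i 1))

end RealAbVar

end

noncomputable section

namespace RealAbVar

variable {n N : ℕ}

/-! ### The real coordinates `F_Z` -/

/-! In the real coordinates `FZ Z` everything becomes an integral matrix: `LZ Z` is ℤ²ⁿ, Im `HZ Z`
is -J, and `kappaZ γ Z` is ᵗγ I₋ as soon as γ·Z = τ(Z) (`kappaZ_FZ`). Conversely, an antilinear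
involution with matrix ᵗγ I₋ forces γ·Z = τ(Z) (`isRealPoint_of_kappaMat`).

Existence. Take a symplectic basis {uᵢ, vⱼ} lifting the level structure. Isotropy and positivity
make the vⱼ a complex basis, and the coordinates of the uᵢ in it form a period matrix Z ∈ 𝔥ₙ
(`exists_siegel`). Transported to these coordinates, κ has an integral matrix P. Compatibility with
the polarization says ᵗPJP = -J and compatibility with the level structure says P ≡ I₋ mod N, so P =
ᵗγ I₋ with γ ∈ Γ(N).

Uniqueness. If γ and γ' both fit Z, their matrices differ by an integral matrix that is congruent to
1 mod N and is an isometry of Re `HZ Z`. For N ≥ 3 such a matrix is 1 (`eq_one_of_isometry`).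

Cohomology. κ² = 1 reads γ τ(γ) = 1, the cocycle condition. An isomorphism 𝒜_Z → 𝒜_Z' has an
integral matrix P with ᵗP ∈ Γ(N). Commuting with the real structures reads γ ᵗP = τ(ᵗP) γ', which
says that the cocycles are cohomologous. -/

/-- The real part of `Z`. -/
def Siegel.X (Z : Siegel n) : Matrix (Fin n) (Fin n) ℝ := Z.mat.map Complex.re

/-- The imaginary part of `Z`. -/
def Siegel.Y (Z : Siegel n) : Matrix (Fin n) (Fin n) ℝ := Z.mat.map Complex.im

theorem Siegel.X_transpose (Z : Siegel n) : Z.Xᵀ = Z.X := by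
  rw [Siegel.X, ← transpose_map, Z.symm]

theorem Siegel.Y_transpose (Z : Siegel n) : Z.Yᵀ = Z.Y := by
  rw [Siegel.Y, ← transpose_map, Z.symm]

theorem Siegel.Y_posDef (Z : Siegel n) : Z.Y.PosDef := Z.im_pos

theorem Siegel.Y_isUnit_det (Z : Siegel n) : IsUnit Z.Y.det :=
  (Matrix.isUnit_iff_isUnit_det _).1 Z.Y_posDef.isUnit

theorem re_FZ (Z : Siegel n) (w : Fin n ⊕ Fin n → ℝ) :
    (fun i => (FZ Z w i).re) = Z.X *ᵥ (w ∘ Sum.inl) + w ∘ Sum.inr := by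
  ext i
  simp [FZ, Siegel.X, mulVec, dotProduct]

theorem im_FZ (Z : Siegel n) (w : Fin n ⊕ Fin n → ℝ) :
    (fun i => (FZ Z w i).im) = Z.Y *ᵥ (w ∘ Sum.inl) := by
  ext i
  simp [FZ, Siegel.Y, mulVec, dotProduct]

theorem FZ_injective (Z : Siegel n) : Function.Injective (FZ Z) := by
  refine (injective_iff_map_eq_zero _).2 fun w hw => ?_
  have hi := im_FZ Z w
  have hr := re_FZ Z w
  simp only [hw, Pi.zero_apply, Complex.zero_im, Complex.zero_re] at hi hr
  have hx : w ∘ Sum.inl = 0 := by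
    have := congrArg (fun v => Z.Y⁻¹ *ᵥ v) hi
    simp only [mulVec_mulVec, nonsing_inv_mul _ Z.Y_isUnit_det, one_mulVec] at this
    rw [← this]
    exact mulVec_zero _
  rw [hx, mulVec_zero, zero_add] at hr
  ext i
  rcases i with i | i
  · exact congrFun hx i
  · exact (congrFun hr i).symm

theorem FZ_surjective (Z : Siegel n) : Function.Surjective (FZ Z) := by
  intro u
  let x : Fin n → ℝ := Z.Y⁻¹ *ᵥ fun i => (u i).im
  let w : Fin n ⊕ Fin n → ℝ := Sum.elim x ((fun i => (u i).re) - Z.X *ᵥ x)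
  refine ⟨w, ?_⟩
  have hi : (fun i => (FZ Z w i).im) = fun i => (u i).im := by
    simp only [im_FZ, w, x, Sum.elim_comp_inl, mulVec_mulVec,
      mul_nonsing_inv _ Z.Y_isUnit_det, one_mulVec]
  have hr : (fun i => (FZ Z w i).re) = fun i => (u i).re := by
    simp only [re_FZ, w, Sum.elim_comp_inl, Sum.elim_comp_inr, add_sub_cancel]
  ext i
  exact Complex.ext (congrFun hr i) (congrFun hi i)

theorem FZ_eq_sum (Z : Siegel n) (w : Fin n ⊕ Fin n → ℝ) :
    FZ Z w = ∑ k, w k • FZ Z (Pi.single k 1) := by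
  conv_lhs => rw [LinearMap.pi_apply_eq_sum_univ (FZ Z) w]
  refine Finset.sum_congr rfl fun k _ => ?_
  congr 2
  ext j
  simp [Pi.single_apply, eq_comm]

theorem FZ_single_inl (Z : Siegel n) (i : Fin n) :
    FZ Z (Pi.single (Sum.inl i) 1) = fun k => Z.mat k i := by
  ext k
  simp [FZ, mulVec, dotProduct, Pi.single_apply, apply_ite]

theorem FZ_single_inr (Z : Siegel n) (i : Fin n) :
    FZ Z (Pi.single (Sum.inr i) 1) = Pi.single i 1 := by
  ext k
  simp [FZ, mulVec, dotProduct, Pi.single_apply, apply_ite]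

/-- An integral vector as a real vector. -/
abbrev realVec (w : Fin n ⊕ Fin n → ℤ) : Fin n ⊕ Fin n → ℝ := fun k => (w k : ℝ)

theorem mem_LZ_iff (Z : Siegel n) (u : Cn n) : u ∈ LZ Z ↔ ∃ w, FZ Z (realVec w) = u := by
  rw [LZ, Submodule.mem_span_range_iff_exists_fun]
  refine exists_congr fun w => ?_
  rw [FZ_eq_sum]
  simp only [realVec, Int.cast_smul_eq_zsmul]

/-! ### The form `H_Z` -/

theorem im_HZ (Z : Siegel n) (u v : Cn n) :
    (HZ Z u v).im = (fun i => (u i).im) ⬝ᵥ (Z.Y⁻¹ *ᵥ fun i => (v i).re) -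
      (fun i => (u i).re) ⬝ᵥ (Z.Y⁻¹ *ᵥ fun i => (v i).im) := by
  change (u ⬝ᵥ ((Z.Y⁻¹.map Complex.ofReal) *ᵥ (star v))).im = _
  simp only [mulVec, dotProduct, Finset.mul_sum, Complex.im_sum, ← Finset.sum_sub_distrib]
  refine Finset.sum_congr rfl fun i _ => Finset.sum_congr rfl fun j _ => ?_
  simp
  ring

theorem re_HZ (Z : Siegel n) (u v : Cn n) :
    (HZ Z u v).re = (fun i => (u i).re) ⬝ᵥ (Z.Y⁻¹ *ᵥ fun i => (v i).re) +
      (fun i => (u i).im) ⬝ᵥ (Z.Y⁻¹ *ᵥ fun i => (v i).im) := by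
  change (u ⬝ᵥ ((Z.Y⁻¹.map Complex.ofReal) *ᵥ (star v))).re = _
  simp only [mulVec, dotProduct, Finset.mul_sum, Complex.re_sum, ← Finset.sum_add_distrib]
  refine Finset.sum_congr rfl fun i _ => Finset.sum_congr rfl fun j _ => ?_
  simp

theorem HZ_pos (Z : Siegel n) {u : Cn n} (hu : u ≠ 0) : 0 < (HZ Z u u).re := by
  rw [re_HZ]
  have hP := Z.Y_posDef.inv
  have h0 : ∀ x : Fin n → ℝ, 0 ≤ x ⬝ᵥ (Z.Y⁻¹ *ᵥ x) := fun x => by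
    simpa using hP.posSemidef.dotProduct_mulVec_nonneg x
  have h1 : ∀ x : Fin n → ℝ, x ≠ 0 → 0 < x ⬝ᵥ (Z.Y⁻¹ *ᵥ x) := fun x hx => by
    simpa using hP.dotProduct_mulVec_pos hx
  by_cases hr : (fun i => (u i).re) = 0
  · refine add_pos_of_nonneg_of_pos (h0 _) (h1 _ fun hi => hu ?_)
    ext i
    exact Complex.ext (congrFun hr i) (congrFun hi i)
  · exact add_pos_of_pos_of_nonneg (h1 _ hr) (h0 _)

/-- `F_Z` carries the form `Im H_Z` to the standard symplectic form. -/
theorem im_HZ_FZ (Z : Siegel n) (w w' : Fin n ⊕ Fin n → ℝ) :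
    (HZ Z (FZ Z w) (FZ Z w')).im = w ⬝ᵥ (-J (Fin n) ℝ *ᵥ w') := by
  have hYX : ∀ x v : Fin n → ℝ, (Z.Y *ᵥ x) ⬝ᵥ (Z.Y⁻¹ *ᵥ v) = x ⬝ᵥ v := fun x v => by
    rw [dotProduct_mulVec, ← vecMul_transpose, vecMul_vecMul, Z.Y_transpose,
      mul_nonsing_inv _ Z.Y_isUnit_det, vecMul_one]
  rw [im_HZ, re_FZ, im_FZ, re_FZ, im_FZ, hYX, mulVec_mulVec,
    nonsing_inv_mul _ Z.Y_isUnit_det, one_mulVec]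
  -- Symmetry of Re Z cancels the terms pairing the first halves of w and w'.
  have hX : (Z.X *ᵥ (w ∘ Sum.inl)) ⬝ᵥ (w' ∘ Sum.inl) =
      (w ∘ Sum.inl) ⬝ᵥ (Z.X *ᵥ (w' ∘ Sum.inl)) := by
    rw [dotProduct_mulVec, ← vecMul_transpose, Z.X_transpose]
  have hJ : -J (Fin n) ℝ *ᵥ w' = Sum.elim (w' ∘ Sum.inr) (-(w' ∘ Sum.inl)) := by
    simp [J, fromBlocks_neg, fromBlocks_mulVec, neg_mulVec]
  rw [hJ, add_dotProduct, dotProduct_add, hX]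
  have : ∀ a b : Fin n → ℝ, w ⬝ᵥ Sum.elim a b = (w ∘ Sum.inl) ⬝ᵥ a + (w ∘ Sum.inr) ⬝ᵥ b :=
    fun a b => by simp [dotProduct]
  rw [this, dotProduct_neg]
  ring

/-! ### Forms determined by their imaginary part -/

/-- Linearity in the first variable makes Im H determine H, so every comparison of forms below is
made on imaginary parts only. -/
theorem re_eq_im_I_smul (H : Cn n →ₗ[ℂ] Cn n →ₗ⋆[ℂ] ℂ) (u v : Cn n) :
    (H u v).re = (H (Complex.I • u) v).im := by
  simp

/-- An antilinear map reversing the sign of `Im H` preserves `Re H`. -/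
theorem re_eq_of_im_eq_neg {H H' : Cn n →ₗ[ℂ] Cn n →ₗ⋆[ℂ] ℂ} {κ : Cn n →ₗ⋆[ℂ] Cn n}
    (h : ∀ u v, (H' (κ u) (κ v)).im = -(H u v).im) (u v : Cn n) :
    (H' (κ u) (κ v)).re = (H u v).re := by
  rw [re_eq_im_I_smul, re_eq_im_I_smul,
    show Complex.I • κ u = κ (-(Complex.I • u)) by simp [LinearMap.map_smulₛₗ], h]
  simp

/-- A hermitian form is determined by the values of its imaginary part. -/
theorem form_ext {H H' : Cn n →ₗ[ℂ] Cn n →ₗ⋆[ℂ] ℂ} {φ : Cn n →ₗ[ℂ] Cn n}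
    (h : ∀ u v, (H' (φ u) (φ v)).im = (H u v).im) (u v : Cn n) :
    H' (φ u) (φ v) = H u v := by
  refine Complex.ext ?_ (h u v)
  rw [re_eq_im_I_smul, re_eq_im_I_smul, ← map_smul φ, h]

/-! ### The real structure `κ(γ, Z)` -/

/-- An integral matrix as a real matrix. -/
abbrev realMat (P : Matrix (Fin n ⊕ Fin n) (Fin n ⊕ Fin n) ℤ) :
    Matrix (Fin n ⊕ Fin n) (Fin n ⊕ Fin n) ℝ := P.map (Int.castRingHom ℝ)

theorem realMat_mul (P P' : Matrix (Fin n ⊕ Fin n) (Fin n ⊕ Fin n) ℤ) :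
    realMat (P * P') = realMat P * realMat P' := Matrix.map_mul

/-- The integral matrix of `κ(γ, Z)` in the symplectic basis of `L_Z`. -/
def kappaMat (γ : SpZ n) : Matrix (Fin n ⊕ Fin n) (Fin n ⊕ Fin n) ℤ := γ.1ᵀ * Iminus n

theorem complex_mulVec (P : Matrix (Fin n) (Fin n) ℤ) (x : Fin n → ℝ) :
    (fun i => ((P.map (Int.castRingHom ℝ) *ᵥ x) i : ℂ)) =
      P.map (Int.cast : ℤ → ℂ) *ᵥ fun i => (x i : ℂ) := by
  ext i
  simp [mulVec, dotProduct]

theorem kappaMat_mulVec (γ : SpZ n) (w : Fin n ⊕ Fin n → ℝ) :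
    realMat (kappaMat γ) *ᵥ w = Sum.elim
      (-((γ.1.toBlocks₁₁ᵀ.map (Int.castRingHom ℝ)) *ᵥ (w ∘ Sum.inl)) +
        (γ.1.toBlocks₂₁ᵀ.map (Int.castRingHom ℝ)) *ᵥ (w ∘ Sum.inr))
      (-((γ.1.toBlocks₁₂ᵀ.map (Int.castRingHom ℝ)) *ᵥ (w ∘ Sum.inl)) +
        (γ.1.toBlocks₂₂ᵀ.map (Int.castRingHom ℝ)) *ᵥ (w ∘ Sum.inr)) := by
  conv_lhs => rw [kappaMat, ← fromBlocks_toBlocks γ.1]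
  rw [Iminus, fromBlocks_transpose, fromBlocks_multiply, realMat, fromBlocks_map,
    fromBlocks_mulVec]
  simp [← neg_mulVec, Matrix.map_neg]

/-- Only the symmetry of Z enters, not γ·Z = τ(Z). The formula can therefore be used to deduce that
Z is a real point. -/
theorem FZ_kappaMat (γ : SpZ n) (Z : Siegel n) (w : Fin n ⊕ Fin n → ℝ) :
    FZ Z (realMat (kappaMat γ) *ᵥ w) =
      (blkC γ * Z.mat + blkD γ)ᵀ *ᵥ (fun j => (w (Sum.inr j) : ℂ)) -
        (blkA γ * Z.mat + blkB γ)ᵀ *ᵥ (fun j => (w (Sum.inl j) : ℂ)) := by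
  rw [kappaMat_mulVec]
  have h : ∀ (P P' : Matrix (Fin n) (Fin n) ℤ) (x y : Fin n → ℝ),
      (fun i => ((-(P.map (Int.castRingHom ℝ) *ᵥ x) + P'.map (Int.castRingHom ℝ) *ᵥ y) i : ℂ)) =
      -(P.map (Int.cast : ℤ → ℂ) *ᵥ fun i => (x i : ℂ)) +
        P'.map (Int.cast : ℤ → ℂ) *ᵥ fun i => (y i : ℂ) := fun P P' x y => by
    rw [← complex_mulVec, ← complex_mulVec]
    ext i
    simp
  change Z.mat *ᵥ (fun i => ((-(_ *ᵥ _) + _ *ᵥ _ : Fin n → ℝ) i : ℂ)) +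
    (fun i => ((-(_ *ᵥ _) + _ *ᵥ _ : Fin n → ℝ) i : ℂ)) = _
  rw [h, h]
  simp only [transpose_add, transpose_mul, Z.symm, blkA, blkB, blkC, blkD, ← transpose_map,
    add_mulVec, mulVec_add, mulVec_neg, mulVec_mulVec, Function.comp_def]
  abel

theorem star_FZ (Z : Siegel n) (w : Fin n ⊕ Fin n → ℝ) :
    star (FZ Z w) = (Z.mat.map (starRingEnd ℂ)) *ᵥ (fun j => (w (Sum.inl j) : ℂ)) +
      fun j => (w (Sum.inr j) : ℂ) := by
  ext i
  simp [FZ, mulVec, dotProduct]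

/-- At a `γ`-real point, `CZ + D` is invertible. -/
theorem IsRealPoint.isUnit_det {γ : SpZ n} {Z : Siegel n} (h : IsRealPoint γ Z) :
    IsUnit (blkC γ * Z.mat + blkD γ).det := by
  by_contra hd
  -- A singular matrix has inverse 0 by convention, so τ(Z) would be 0. Then Im Z = 0 contradicts
  -- its invertibility, except for n = 0, where the determinant is 1.
  rw [IsRealPoint, act, nonsing_inv_apply_not_isUnit _ hd, mul_zero] at h
  have hZ : Z.mat = 0 := by
    ext i j
    have := congrFun (congrFun h i) j
    simpa [tauH] using this.symm
  have hY : Z.Y = 0 := by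
    rw [Siegel.Y, hZ]
    ext i j
    simp
  have h1 := nonsing_inv_mul _ Z.Y_isUnit_det
  rw [hY, mul_zero] at h1
  rcases isEmpty_or_nonempty (Fin n) with hn | ⟨⟨i⟩⟩
  · exact hd (by simp)
  · simpa using congrFun (congrFun h1 i) i

/-- Clear the denominator CZ + D and transpose, using that Z̄ is symmetric. This is the shape in
which the equation meets `FZ_kappaMat`. -/
theorem isRealPoint_iff {γ : SpZ n} {Z : Siegel n}
    (hd : IsUnit (blkC γ * Z.mat + blkD γ).det) : IsRealPoint γ Z ↔
      (blkC γ * Z.mat + blkD γ)ᵀ * Z.mat.map (starRingEnd ℂ) = -(blkA γ * Z.mat + blkB γ)ᵀ := by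
  have hs : (Z.mat.map (starRingEnd ℂ))ᵀ = Z.mat.map (starRingEnd ℂ) := by
    rw [← transpose_map, Z.symm]
  have h1 : (blkC γ * Z.mat + blkD γ)ᵀ * Z.mat.map (starRingEnd ℂ) =
      (Z.mat.map (starRingEnd ℂ) * (blkC γ * Z.mat + blkD γ))ᵀ := by
    rw [transpose_mul, hs]
  rw [h1, ← transpose_neg, transpose_inj, IsRealPoint, act, tauH]
  constructor
  · intro h
    have h2 := congrArg (· * (blkC γ * Z.mat + blkD γ)) h
    simp only [Matrix.mul_assoc, nonsing_inv_mul _ hd, mul_one, Matrix.neg_mul] at h2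
    rw [h2, neg_neg]
  · intro h
    rw [← neg_neg (blkA γ * Z.mat + blkB γ), ← h, Matrix.neg_mul, Matrix.mul_assoc,
      mul_nonsing_inv _ hd, mul_one]

/-- The left side is ᵗ(CZ+D)(Z̄x + y), the right side ᵗ(CZ+D)y - ᵗ(AZ+B)x. They agree exactly by the
real point equation. -/
theorem kappaZ_FZ {γ : SpZ n} {Z : Siegel n} (h : IsRealPoint γ Z) (w : Fin n ⊕ Fin n → ℝ) :
    kappaZ γ Z (FZ Z w) = FZ Z (realMat (kappaMat γ) *ᵥ w) := by
  change (blkC γ * Z.mat + blkD γ)ᵀ *ᵥ star (FZ Z w) = _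
  rw [star_FZ, FZ_kappaMat, mulVec_add, mulVec_mulVec, (isRealPoint_iff h.isUnit_det).1 h,
    neg_mulVec]
  abel

/-- γ preserves J and I₋ reverses its sign. -/
theorem transpose_kappaMat_mul_J_mul (γ : SpZ n) :
    (kappaMat γ)ᵀ * J (Fin n) ℤ * kappaMat γ = -J (Fin n) ℤ := by
  have hT : (Iminus n)ᵀ = Iminus n := by simp [Iminus, fromBlocks_transpose]
  have hJ : Iminus n * J (Fin n) ℤ * Iminus n = -J (Fin n) ℤ := by
    simp [Iminus, J, fromBlocks_multiply, fromBlocks_neg]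
  have h := SymplecticGroup.mem_iff.1 γ.2
  calc (kappaMat γ)ᵀ * J (Fin n) ℤ * kappaMat γ
      = Iminus n * (γ.1 * J (Fin n) ℤ * γ.1ᵀ) * Iminus n := by
        simp only [kappaMat, transpose_mul, hT, transpose_transpose, Matrix.mul_assoc]
    _ = _ := by rw [h, hJ]

theorem dotProduct_mulVec_mulVec (P S : Matrix (Fin n ⊕ Fin n) (Fin n ⊕ Fin n) ℝ)
    (w w' : Fin n ⊕ Fin n → ℝ) :
    (P *ᵥ w) ⬝ᵥ (S *ᵥ (P *ᵥ w')) = w ⬝ᵥ ((Pᵀ * S * P) *ᵥ w') := by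
  rw [← vecMul_transpose, ← dotProduct_mulVec, mulVec_mulVec, mulVec_mulVec, Matrix.mul_assoc]

theorem im_HZ_kappaZ {γ : SpZ n} {Z : Siegel n} (h : IsRealPoint γ Z) (u v : Cn n) :
    (HZ Z (kappaZ γ Z u) (kappaZ γ Z v)).im = -(HZ Z u v).im := by
  obtain ⟨w, rfl⟩ := FZ_surjective Z u
  obtain ⟨w', rfl⟩ := FZ_surjective Z v
  have hK := congrArg realMat (transpose_kappaMat_mul_J_mul γ)
  simp only [realMat_mul] at hK
  have hJ : realMat (J (Fin n) ℤ) = J (Fin n) ℝ := map_J _ _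
  have hJ' : realMat (-J (Fin n) ℤ) = -J (Fin n) ℝ := by
    rw [← hJ]; ext; simp [-map_J]
  rw [hJ, hJ', realMat, transpose_map] at hK
  rw [kappaZ_FZ h, kappaZ_FZ h, im_HZ_FZ, im_HZ_FZ, dotProduct_mulVec_mulVec, Matrix.mul_neg,
    Matrix.neg_mul, hK, neg_mulVec, dotProduct_neg]

/-! ### Rigidity of the level structure -/

theorem realVec_mulVec (P : Matrix (Fin n ⊕ Fin n) (Fin n ⊕ Fin n) ℤ) (w : Fin n ⊕ Fin n → ℤ) :
    realVec (P *ᵥ w) = realMat P *ᵥ realVec w := by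
  ext i
  simp [realVec, mulVec, dotProduct]

theorem realMat_one : realMat (1 : Matrix (Fin n ⊕ Fin n) (Fin n ⊕ Fin n) ℤ) = 1 :=
  Matrix.map_one _ (map_zero _) (map_one _)

/-- A positive definite bilinear form on a real coordinate space dominates the norm. -/
theorem exists_norm_sq_le {ι : Type*} [Fintype ι] {B : LinearMap.BilinForm ℝ (ι → ℝ)}
    (hpos : ∀ w, w ≠ 0 → 0 < B w w) : ∃ c > 0, ∀ w, c * ‖w‖ ^ 2 ≤ B w w := by
  have hc : Continuous fun w => B w w := by
    have h1 : Continuous fun w => LinearMap.toContinuousLinearMap (B w) :=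
      (LinearMap.toContinuousLinearMap.toLinearMap.comp B).continuous_of_finiteDimensional
    exact h1.clm_apply continuous_id
  rcases (Metric.sphere (0 : ι → ℝ) 1).eq_empty_or_nonempty with he | hne
  -- An empty unit sphere means the space is zero, and any constant works.
  · refine ⟨1, one_pos, fun w => ?_⟩
    by_cases hw : w = 0
    · simp [hw]
    · have : ‖w‖⁻¹ • w ∈ Metric.sphere (0 : ι → ℝ) 1 := by
        simp [norm_smul, inv_mul_cancel₀ (norm_ne_zero_iff.2 hw)]
      simp [he] at this
  · obtain ⟨v, hv, hmin⟩ := (isCompact_sphere (0 : ι → ℝ) 1).exists_isMinOn hne hc.continuousOn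
    have hv0 : v ≠ 0 := by
      rintro rfl
      simp at hv
    refine ⟨B v v, hpos v hv0, fun w => ?_⟩
    by_cases hw : w = 0
    · simp [hw]
    · have hn := norm_ne_zero_iff.2 hw
      have hmem : ‖w‖⁻¹ • w ∈ Metric.sphere (0 : ι → ℝ) 1 := by
        simp [norm_smul, inv_mul_cancel₀ hn]
      have hle : B v v ≤ B (‖w‖⁻¹ • w) (‖w‖⁻¹ • w) := hmin hmem
      simp only [map_smul, LinearMap.smul_apply, smul_eq_mul] at hle
      calc B v v * ‖w‖ ^ 2 ≤ ‖w‖⁻¹ * (‖w‖⁻¹ * B w w) * ‖w‖ ^ 2 :=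
            mul_le_mul_of_nonneg_right hle (by positivity)
        _ = B w w := by field_simp

/-- An integral isometry of a positive definite form that is congruent to `1` modulo `N ≥ 3`
is trivial. -/
theorem eq_one_of_isometry (hN : 3 ≤ N) {B : LinearMap.BilinForm ℝ (Fin n ⊕ Fin n → ℝ)}
    (hsymm : ∀ v w, B v w = B w v) (hpos : ∀ w, w ≠ 0 → 0 < B w w)
    {P : Matrix (Fin n ⊕ Fin n) (Fin n ⊕ Fin n) ℤ}
    (hP : ∀ v w, B (realMat P *ᵥ v) (realMat P *ᵥ w) = B v w) (hred : redMod n N P = 1) :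
    P = 1 := by
  obtain ⟨M, rfl⟩ : ∃ M : Matrix (Fin n ⊕ Fin n) (Fin n ⊕ Fin n) ℤ, P = 1 + (N : ℤ) • M := by
    have h : ∀ i j, (N : ℤ) ∣ (P - 1) i j := fun i j => by
      have h1 : redMod n N (P - 1) = 0 := by rw [map_sub, hred, map_one, sub_self]
      exact (ZMod.intCast_zmod_eq_zero_iff_dvd _ N).1 (congrFun (congrFun h1 i) j)
    choose M hM using h
    refine ⟨Matrix.of M, ?_⟩
    ext i j
    have := hM i j
    simp only [Matrix.sub_apply] at this
    simp only [Matrix.add_apply, Matrix.smul_apply, of_apply, smul_eq_mul]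
    linarith
  have hNR : (3 : ℝ) ≤ N := by exact_mod_cast hN
  have hPv : ∀ v, realMat (1 + (N : ℤ) • M) *ᵥ v = v + (N : ℝ) • (realMat M *ᵥ v) := fun v => by
    have : realMat (1 + (N : ℤ) • M) = 1 + (N : ℝ) • realMat M := by
      ext i j
      change (((1 : Matrix _ _ ℤ) i j + (N : ℤ) * M i j : ℤ) : ℝ) =
        (1 : Matrix _ _ ℝ) i j + (N : ℝ) * (M i j : ℝ)
      simp [Matrix.one_apply, apply_ite]
    rw [this, add_mulVec, one_mulVec, smul_mulVec]
  simp only [hPv] at hP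
  have hnonneg : ∀ w, 0 ≤ B w w := fun w => by
    by_cases hw : w = 0
    · simp [hw]
    · exact (hpos w hw).le
  -- With P = 1 + NM, this is ‖NMv‖ = ‖Pv - v‖ ≤ 2‖v‖ in the norm of B, squared. The bound N ≥ 3
  -- makes the ratio 4/N² at most 4/9 < 1.
  have hcontr : ∀ v, B (realMat M *ᵥ v) (realMat M *ᵥ v) ≤ 4 / 9 * B v v := fun v => by
    have h1 := hP v v
    have h2 := hnonneg (v + v + (N : ℝ) • (realMat M *ᵥ v))
    simp only [map_add, LinearMap.add_apply, map_smul, LinearMap.smul_apply, smul_eq_mul,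
      hsymm (realMat M *ᵥ v) v] at h1 h2
    have h3 : (N : ℝ) * (N * B (realMat M *ᵥ v) (realMat M *ᵥ v)) ≤ 4 * B v v := by linarith
    have h4 := mul_le_mul_of_nonneg_right (by nlinarith : (9 : ℝ) ≤ N * N)
      (hnonneg (realMat M *ᵥ v))
    linarith
  have hiter : ∀ (k : ℕ) (v : Fin n ⊕ Fin n → ℤ),
      B (realVec (M ^ k *ᵥ v)) (realVec (M ^ k *ᵥ v)) ≤ (4 / 9) ^ k * B (realVec v) (realVec v) := by
    intro k v
    induction k with
    | zero => simp
    | succ k ih =>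
      rw [pow_succ', ← mulVec_mulVec, realVec_mulVec, pow_succ']
      linarith [hcontr (realVec (M ^ k *ᵥ v))]
  obtain ⟨c, hc, hcB⟩ := exists_norm_sq_le hpos
  -- The iterates Mᵏv are integral and tend to 0, so they eventually vanish.
  have hnil : ∀ v : Fin n ⊕ Fin n → ℤ, ∃ k, M ^ k *ᵥ v = 0 := by
    intro v
    have ht : Filter.Tendsto (fun k : ℕ => (4 / 9 : ℝ) ^ k * B (realVec v) (realVec v))
        Filter.atTop (nhds 0) := by
      simpa using (tendsto_pow_atTop_nhds_zero_of_lt_one (by norm_num : (0 : ℝ) ≤ 4 / 9)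
        (by norm_num)).mul_const (B (realVec v) (realVec v))
    obtain ⟨k, hk⟩ := (ht.eventually (gt_mem_nhds hc)).exists
    refine ⟨k, ?_⟩
    have h1 : ‖realVec (M ^ k *ᵥ v)‖ ^ 2 < 1 := by
      have := (hcB (realVec (M ^ k *ᵥ v))).trans_lt ((hiter k v).trans_lt hk)
      nlinarith
    have h2 : ‖realVec (M ^ k *ᵥ v)‖ < 1 := by
      rwa [sq_lt_one_iff₀ (norm_nonneg _)] at h1
    ext i
    have h3 := (norm_le_pi_norm (realVec (M ^ k *ᵥ v)) i).trans_lt h2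
    rw [Real.norm_eq_abs] at h3
    exact Int.abs_lt_one_iff.1 (by exact_mod_cast h3)
  -- If M²v = 0, then P fixes Mv, and the isometry identity for the pair (v, Mv) leaves N·B(Mv, Mv)
  -- = 0. So ker M² = ker M, and a nilpotent M of this kind is 0.
  have hstep : ∀ v : Fin n ⊕ Fin n → ℤ, M *ᵥ (M *ᵥ v) = 0 → M *ᵥ v = 0 := by
    intro v hv
    have h0 : realMat M *ᵥ (realMat M *ᵥ realVec v) = 0 := by
      rw [← realVec_mulVec, ← realVec_mulVec, hv]
      ext
      simp
    have h1 := hP (realVec v) (realMat M *ᵥ realVec v)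
    simp only [h0, smul_zero, add_zero, map_add, LinearMap.add_apply, map_smul,
      LinearMap.smul_apply, smul_eq_mul, add_eq_left, mul_eq_zero] at h1
    have h2 : B (realMat M *ᵥ realVec v) (realMat M *ᵥ realVec v) = 0 :=
      h1.resolve_left (by positivity)
    have h3 : realMat M *ᵥ realVec v = 0 := by
      by_contra h
      exact (hpos _ h).ne' h2
    rw [← realVec_mulVec] at h3
    ext i
    have h4 : ((M *ᵥ v) i : ℝ) = 0 := congrFun h3 i
    exact_mod_cast h4
  have hdesc : ∀ (k : ℕ) (v : Fin n ⊕ Fin n → ℤ), M ^ (k + 1) *ᵥ v = 0 → M *ᵥ v = 0 := by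
    intro k
    induction k with
    | zero => intro v hv; simpa using hv
    | succ k ih =>
      intro v hv
      rw [pow_succ, ← mulVec_mulVec] at hv
      exact hstep v (ih _ hv)
  have hM : M = 0 := by
    refine Matrix.ext_of_mulVec_single fun i => ?_
    obtain ⟨k, hk⟩ := hnil (Pi.single i 1)
    rw [zero_mulVec]
    refine hdesc k _ ?_
    rw [pow_succ', ← mulVec_mulVec, hk, mulVec_zero]
  simp [hM]

/-- The positive definite form `Re H_Z` in the real coordinates `F_Z`. -/
def reForm (Z : Siegel n) : LinearMap.BilinForm ℝ (Fin n ⊕ Fin n → ℝ) :=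
  LinearMap.mk₂ ℝ (fun v w => (HZ Z (FZ Z v) (FZ Z w)).re)
    (fun v v' w => by simp)
    (fun c v w => by
      rw [map_smul, ← Complex.coe_smul, map_smul]
      simp)
    (fun v w w' => by simp)
    (fun c v w => by
      rw [map_smul, ← Complex.coe_smul, LinearMap.map_smulₛₗ]
      simp)

theorem re_HZ_symm (Z : Siegel n) (u v : Cn n) : (HZ Z u v).re = (HZ Z v u).re := by
  have hY : (Z.Y⁻¹)ᵀ = Z.Y⁻¹ := by rw [transpose_nonsing_inv, Z.Y_transpose]
  have : ∀ x y : Fin n → ℝ, x ⬝ᵥ (Z.Y⁻¹ *ᵥ y) = y ⬝ᵥ (Z.Y⁻¹ *ᵥ x) := fun x y => by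
    rw [dotProduct_mulVec, dotProduct_comm, ← mulVec_transpose, hY]
  rw [re_HZ, re_HZ, this, this (fun i => (u i).im)]

theorem reForm_kappaMat {γ : SpZ n} {Z : Siegel n} (h : IsRealPoint γ Z)
    (v w : Fin n ⊕ Fin n → ℝ) :
    reForm Z (realMat (kappaMat γ) *ᵥ v) (realMat (kappaMat γ) *ᵥ w) = reForm Z v w := by
  change (HZ Z (FZ Z _) (FZ Z _)).re = (HZ Z (FZ Z v) (FZ Z w)).re
  rw [← kappaZ_FZ h, ← kappaZ_FZ h, re_eq_of_im_eq_neg (im_HZ_kappaZ h)]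

theorem coe_tauSp (g : SpZ n) : (tauSp n g).1 = Iminus n * g.1 * Iminus n := rfl

/-- The inner factors I₋ cancel. With h = γ'γ⁻¹ this expresses the quotient of two real structures
at the same Z as an element of Γ(N). -/
theorem kappaMat_mul_transpose_tauSp (g h : SpZ n) :
    kappaMat g * (tauSp n h).1ᵀ = kappaMat (h * g) := by
  have hT : (Iminus n)ᵀ = Iminus n := by simp [Iminus, fromBlocks_transpose]
  rw [kappaMat, kappaMat, coe_tauSp, transpose_mul, transpose_mul, hT]
  calc g.1ᵀ * Iminus n * (Iminus n * (h.1ᵀ * Iminus n))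
      = g.1ᵀ * (Iminus n * Iminus n) * h.1ᵀ * Iminus n := by simp only [Matrix.mul_assoc]
    _ = (h * g).1ᵀ * Iminus n := by
      rw [Iminus_mul_self, mul_one]
      change _ = (h.1 * g.1)ᵀ * _
      rw [transpose_mul]

/-- At most one element of `Γ(N)`, `N ≥ 3`, carries `Z` to `τ(Z)`. -/
theorem IsRealPoint.unique (hN : 3 ≤ N) {Z : Siegel n} {γ γ' : Gam n N}
    (h : IsRealPoint γ.1 Z) (h' : IsRealPoint γ'.1 Z) : γ' = γ := by
  set g : SpZ n := tauSp n (γ'.1 * γ.1⁻¹) with hg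
  have hmem : g ∈ Gam n N := tauSp_mem_Gam ((Gam n N).mul_mem γ'.2 ((Gam n N).inv_mem γ.2))
  have hmul : kappaMat γ.1 * g.1ᵀ = kappaMat γ'.1 := by
    rw [hg, kappaMat_mul_transpose_tauSp, inv_mul_cancel_right]
  have hone : g.1ᵀ = 1 := by
    refine eq_one_of_isometry hN (B := reForm Z) (fun v w => re_HZ_symm Z _ _) (fun w hw => ?_)
      (fun v w => ?_) ?_
    · exact HZ_pos Z fun h0 => hw (FZ_injective Z (h0.trans (map_zero _).symm))
    · rw [← reForm_kappaMat h, mulVec_mulVec, mulVec_mulVec, ← realMat_mul, hmul,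
        reForm_kappaMat h']
    · have h1 : redMod n N g.1 = 1 := hmem
      change (g.1ᵀ).map _ = 1
      rw [transpose_map, show g.1.map _ = 1 from h1, transpose_one]
  have hg1 : g = 1 := Subtype.ext (by simpa using congrArg transpose hone)
  have h2 : γ'.1 * γ.1⁻¹ = 1 := by
    rw [← tauSp_tauSp n (γ'.1 * γ.1⁻¹), ← hg, hg1, map_one]
  exact Subtype.ext (mul_inv_eq_one.1 h2)

/-! ### Transport of structure along isomorphisms -/

namespace Quad.IsIso

variable {A A' A'' : Quad n} {φ ψ : Cn n ≃ₗ[ℂ] Cn n}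

theorem map_mem_iff (h : IsIso A A' φ) (u : Cn n) : φ u ∈ A'.L ↔ u ∈ A.L := by
  rw [← SetLike.mem_coe, ← h.map_lattice, φ.injective.mem_set_image, SetLike.mem_coe]

theorem mkQ_eq_iff (h : IsIso A A' φ) (u v : Cn n) :
    A'.L.mkQ (φ u) = A'.L.mkQ (φ v) ↔ A.L.mkQ u = A.L.mkQ v := by
  simp only [Submodule.mkQ_apply, Submodule.Quotient.eq]
  rw [← map_sub, h.map_mem_iff]

theorem level_iff (h : IsIso A A' φ) (i : Fin n ⊕ Fin n) (x : Cn n) :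
    A'.lev i = A'.L.mkQ (φ x) ↔ A.lev i = A.L.mkQ x := by
  obtain ⟨y, hy⟩ := A.L.mkQ_surjective (A.lev i)
  rw [← h.map_level i y hy, ← hy, h.mkQ_eq_iff]

theorem symm (h : IsIso A A' φ) : IsIso A' A φ.symm where
  map_lattice := by
    rw [← h.map_lattice, Set.image_image]
    simp
  map_form u v := by simp [← h.map_form]
  map_real u := by
    apply φ.injective
    simp [h.map_real]
  map_level i x hx := by
    rw [eq_comm, ← h.level_iff, φ.apply_symm_apply, hx]

theorem trans (h : IsIso A A' φ) (h' : IsIso A' A'' ψ) : IsIso A A'' (φ.trans ψ) where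
  map_lattice := by
    rw [← h'.map_lattice, ← h.map_lattice, Set.image_image]
    rfl
  map_form u v := by simp [h'.map_form, h.map_form]
  map_real u := by simp [h.map_real, h'.map_real]
  map_level i x hx := h'.map_level i _ (h.map_level i x hx)

/-- The isomorphism of lattices induced by an isomorphism of quadruples. -/
def latticeEquiv (h : IsIso A A' φ) : A.L ≃ₗ[ℤ] A'.L :=
  (φ.restrictScalars ℤ).ofSubmodules A.L A'.L (SetLike.coe_injective h.map_lattice)

theorem coe_latticeEquiv (h : IsIso A A' φ) (u : A.L) : (h.latticeEquiv u : Cn n) = φ u := rfl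

theorem isLift_map (h : IsIso A A' φ) {b : Module.Basis (Fin n ⊕ Fin n) ℤ A.L}
    (hb : A.IsLift N b) : A'.IsLift N (b.map h.latticeEquiv) := by
  refine ⟨?_, fun i => ?_⟩
  · rw [IsSymplecticBasis, ← hb.1]
    ext i j
    simp [Quad.Q, coe_latticeEquiv, h.map_form]
  · rw [Module.Basis.map_apply, coe_latticeEquiv, ← map_smul, h.level_iff, hb.2]

/-- Every condition pulls back along φ; for `level_compat`, each lift is first pushed forward to A'.
This is how 𝒜_Z acquires all its properties, κ² = 1 included. -/
theorem isRealPPAV (h : IsIso A A' φ) (hA : A'.IsRealPPAV N) : A.IsRealPPAV N where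
  discrete := by
    have := hA.discrete
    refine DiscreteTopology.of_continuous_injective (f := h.latticeEquiv) ?_
      h.latticeEquiv.injective
    refine Continuous.subtype_mk ?_ _
    exact (LinearMap.continuous_of_finiteDimensional (φ : Cn n →ₗ[ℂ] Cn n)).comp
      continuous_subtype_val
  span_top := by
    have h1 : (A.L : Set (Cn n)) =
        ((φ.symm : Cn n →ₗ[ℂ] Cn n).restrictScalars ℝ) '' (A'.L : Set (Cn n)) :=
      h.symm.map_lattice.symm
    rw [h1, Submodule.span_image, hA.span_top, Submodule.map_top, LinearMap.range_eq_top]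
    exact φ.symm.surjective
  hermitian u v := by rw [← h.map_form, ← h.map_form, hA.hermitian]
  pos u hu := by
    rw [← h.map_form]
    exact hA.pos _ (φ.map_ne_zero_iff.2 hu)
  level := by
    obtain ⟨b, hb⟩ := hA.level
    exact ⟨_, h.symm.isLift_map hb⟩
  invol u := φ.injective (by rw [h.map_real, h.map_real, hA.invol])
  map_lattice := by
    have h2 := hA.map_lattice
    rw [← h.map_lattice, Set.image_image] at h2
    refine φ.injective.image_injective ?_
    rw [Set.image_image]
    simpa only [h.map_real] using h2
  compat u v := by
    have := hA.compat (φ u) (φ v)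
    rwa [← h.map_real, ← h.map_real, Quad.Q, Quad.Q, h.map_form, h.map_form] at this
  level_compat b hb := by
    have h1 := hA.level_compat _ (h.isLift_map hb)
    simp only [Module.Basis.map_apply, coe_latticeEquiv, ← map_smul, ← map_neg, ← h.map_real,
      h.mkQ_eq_iff] at h1
    exact h1

end Quad.IsIso

/-! ### The period matrix of a symplectic basis -/

theorem form_sum_sum {ι : Type*} [Fintype ι] (H : Cn n →ₗ[ℂ] Cn n →ₗ⋆[ℂ] ℂ) (x y : ι → ℂ)
    (p : ι → Cn n) : H (∑ i, x i • p i) (∑ j, y j • p j) =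
      ∑ i, ∑ j, x i * (starRingEnd ℂ (y j) * H (p i) (p j)) := by
  simp only [map_sum, LinearMap.sum_apply, LinearMap.map_smulₛₗ, map_smul, LinearMap.smul_apply,
    smul_eq_mul, Finset.mul_sum]
  rw [Finset.sum_comm]
  exact Finset.sum_congr rfl fun i _ => Finset.sum_congr rfl fun j _ => by ring

theorem im_form_sum_sum {ι : Type*} [Fintype ι] (H : Cn n →ₗ[ℂ] Cn n →ₗ⋆[ℂ] ℂ) (x y : ι → ℝ)
    (p : ι → Cn n) : (H (∑ i, x i • p i) (∑ j, y j • p j)).im =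
      x ⬝ᵥ ((Matrix.of fun i j => (H (p i) (p j)).im) *ᵥ y) := by
  have := form_sum_sum H (fun i => (x i : ℂ)) (fun i => (y i : ℂ)) p
  simp only [Complex.coe_smul] at this
  rw [this]
  simp only [Complex.im_sum, dotProduct, mulVec, Finset.mul_sum, of_apply]
  refine Finset.sum_congr rfl fun i _ => Finset.sum_congr rfl fun j _ => ?_
  simp [mul_comm]

theorem re_form_sum_sum {ι : Type*} [Fintype ι] (H : Cn n →ₗ[ℂ] Cn n →ₗ⋆[ℂ] ℂ) (x y : ι → ℝ)
    (p : ι → Cn n) : (H (∑ i, x i • p i) (∑ j, y j • p j)).re =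
      x ⬝ᵥ ((Matrix.of fun i j => (H (p i) (p j)).re) *ᵥ y) := by
  have := form_sum_sum H (fun i => (x i : ℂ)) (fun i => (y i : ℂ)) p
  simp only [Complex.coe_smul] at this
  rw [this]
  simp only [Complex.re_sum, dotProduct, mulVec, Finset.mul_sum, of_apply]
  refine Finset.sum_congr rfl fun i _ => Finset.sum_congr rfl fun j _ => ?_
  simp [mul_comm]

/-- A family of vectors that is isotropic for `Im H` and dual to another one is linearly
independent over `ℂ`. -/
theorem linearIndependent_of_isotropic {H : Cn n →ₗ[ℂ] Cn n →ₗ⋆[ℂ] ℂ}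
    (hpos : ∀ u, u ≠ 0 → 0 < (H u u).re) {u v : Fin n → Cn n}
    (hvv : ∀ i j, (H (v i) (v j)).im = 0)
    (huv : ∀ i j, (H (u i) (v j)).im = (1 : Matrix (Fin n) (Fin n) ℝ) i j) :
    LinearIndependent ℂ v := by
  -- Pairing with uᵢ recovers the i-th real coefficient.
  have hdual : ∀ x : Fin n → ℝ, ∑ j, x j • v j = 0 → x = 0 := by
    intro x hx
    ext i
    have h1 : (H (u i) (∑ j, (x j : ℂ) • v j)).im = x i := by
      simp [-Complex.coe_smul, map_sum, LinearMap.map_smulₛₗ, huv, Matrix.one_apply]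
    simp only [Complex.coe_smul, hx, map_zero, Complex.zero_im] at h1
    exact h1.symm
  rw [Fintype.linearIndependent_iff]
  intro c hc
  set x : Cn n := ∑ j, (c j).re • v j with hx
  set w : Cn n := ∑ j, (c j).im • v j with hw
  have hsum : x + Complex.I • w = 0 := by
    rw [← hc, hx, hw, Finset.smul_sum, ← Finset.sum_add_distrib]
    refine Finset.sum_congr rfl fun j _ => ?_
    conv_rhs => rw [← Complex.re_add_im (c j)]
    rw [← Complex.coe_smul, ← Complex.coe_smul, smul_smul, ← add_smul, mul_comm Complex.I]
  have hz : (Matrix.of fun i j => (H (v i) (v j)).im) = 0 := by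
    ext i j
    exact hvv i j
  -- Since iw = -x, Re H(w, w) = Im H(iw, w) = -Im H(x, w), which is 0 because x and w lie in the
  -- isotropic real span of the vⱼ.
  have hw0 : w = 0 := by
    by_contra h
    refine (hpos w h).ne' ?_
    rw [re_eq_im_I_smul, show Complex.I • w = -x from eq_neg_of_add_eq_zero_right hsum, map_neg,
      LinearMap.neg_apply, Complex.neg_im, hx, hw, im_form_sum_sum, hz, zero_mulVec,
      dotProduct_zero, neg_zero]
  have hx0 : x = 0 := by simpa [hw0] using hsum
  intro i
  exact Complex.ext (congrFun (hdual _ hx0) i) (congrFun (hdual _ hw0) i)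

/-- Z holds the coordinates of the uᵢ in the complex basis vⱼ. On the vⱼ the form is a real positive
definite matrix S; duality with the uᵢ gives Im Z = S⁻¹, and isotropy of the uᵢ gives the symmetry
of Re Z. -/
theorem exists_siegel {H : Cn n →ₗ[ℂ] Cn n →ₗ⋆[ℂ] ℂ}
    (hherm : ∀ u v, H v u = starRingEnd ℂ (H u v)) (hpos : ∀ u, u ≠ 0 → 0 < (H u u).re)
    {b : Fin n ⊕ Fin n → Cn n}
    (hb : (Matrix.of fun i j => (H (b i) (b j)).im) = -J (Fin n) ℝ) :
    ∃ (Z : Siegel n) (φ : Cn n ≃ₗ[ℂ] Cn n), (∀ k, φ (FZ Z (Pi.single k 1)) = b k) ∧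
      ∀ u v, H (φ u) (φ v) = HZ Z u v := by
  have hbe : ∀ i j, (H (b i) (b j)).im = -J (Fin n) ℝ i j := fun i j =>
    congrFun (congrFun hb i) j
  set v : Fin n → Cn n := b ∘ Sum.inr with hv
  have hvv : ∀ i j, (H (v i) (v j)).im = 0 := fun i j => by simp [hv, hbe, J]
  have hli : LinearIndependent ℂ v :=
    linearIndependent_of_isotropic hpos (u := b ∘ Sum.inl) hvv fun i j => by simp [hv, hbe, J]
  let bC := basisOfLinearIndependentOfCardEqFinrank' (K := ℂ) v hli (by simp)
  let φ : Cn n ≃ₗ[ℂ] Cn n := (Pi.basisFun ℂ (Fin n)).equiv bC (Equiv.refl _)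
  have hφv : ∀ j, φ (Pi.single j 1) = v j := fun j => by
    rw [← Pi.basisFun_apply ℂ, Module.Basis.equiv_apply]
    simp [bC]
  have hφ : ∀ x : Cn n, φ x = ∑ j, x j • v j := fun x => by
    conv_lhs => rw [← Finset.univ_sum_single x]
    rw [map_sum]
    refine Finset.sum_congr rfl fun j _ => ?_
    rw [← hφv, ← map_smul, ← Pi.single_smul, smul_eq_mul, mul_one]
  let Zm : Matrix (Fin n) (Fin n) ℂ := Matrix.of fun j i => φ.symm (b (Sum.inl i)) j
  have hu : ∀ i, b (Sum.inl i) = ∑ j, Zm j i • v j := fun i => by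
    rw [← φ.apply_symm_apply (b (Sum.inl i)), hφ]
    simp [Zm]
  let S : Matrix (Fin n) (Fin n) ℝ := Matrix.of fun i j => (H (v i) (v j)).re
  have hS : ∀ i j, H (v i) (v j) = (S i j : ℂ) := fun i j => Complex.ext rfl (hvv i j)
  have hST : Sᵀ = S := by
    ext i j
    simp [S, hherm (v i) (v j)]
  let X := Zm.map Complex.re
  let Y := Zm.map Complex.im
  have hYS : Yᵀ * S = 1 := by
    ext i j
    have h1 : (H (b (Sum.inl i)) (v j)).im = (1 : Matrix (Fin n) (Fin n) ℝ) i j := by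
      simp [hv, hbe, J]
    rw [← h1, hu]
    simp [mul_apply, map_sum, LinearMap.sum_apply, hS, Y]
  have hSY : S * Y = 1 := by
    have := congrArg transpose hYS
    rwa [transpose_mul, transpose_transpose, hST, transpose_one] at this
  -- The left side is the imaginary part of ᵗZ S Z̄, the matrix of H on the uᵢ. By duality it
  -- reduces to X - ᵗX.
  have hXX : Yᵀ * S * X - Xᵀ * (S * Y) = 0 := by
    ext i j
    have h1 : (H (b (Sum.inl i)) (b (Sum.inl j))).im = 0 := by simp [hbe, J]
    rw [hu, hu, form_sum_sum] at h1
    rw [Matrix.zero_apply, ← h1]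
    simp only [mul_apply, Matrix.sub_apply, Finset.sum_mul, Finset.mul_sum, Complex.im_sum]
    rw [Finset.sum_comm, ← Finset.sum_sub_distrib]
    refine Finset.sum_congr rfl fun k _ => ?_
    rw [← Finset.sum_sub_distrib]
    refine Finset.sum_congr rfl fun l _ => ?_
    simp [hS, X, Y]
    ring
  have hXT : Xᵀ = X := by
    rw [hYS, hSY, one_mul, mul_one, sub_eq_zero] at hXX
    exact hXX.symm
  have hSpos : S.PosDef := by
    rw [posDef_iff_dotProduct_mulVec]
    refine ⟨by rw [IsHermitian, conjTranspose_eq_transpose_of_trivial, hST], fun {x} hx => ?_⟩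
    rw [star_trivial, ← re_form_sum_sum]
    refine hpos _ fun h0 => hx ?_
    have h2 : φ (fun j => (x j : ℂ)) = 0 := by
      rw [hφ, ← h0]
      simp
    rw [LinearEquiv.map_eq_zero_iff] at h2
    ext j
    have h3 : (x j : ℂ) = 0 := congrFun h2 j
    exact_mod_cast h3
  have hY : Y = S⁻¹ := (inv_eq_right_inv hSY).symm
  have hYT : Yᵀ = Y := by rw [hY, transpose_nonsing_inv, hST]
  let Z : Siegel n :=
    { mat := Zm
      symm := by
        ext i j
        exact Complex.ext (congrFun (congrFun hXT i) j) (congrFun (congrFun hYT i) j)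
      im_pos := by
        change Y.PosDef
        rw [hY]
        exact hSpos.inv }
  have hφb : ∀ k, φ (FZ Z (Pi.single k 1)) = b k := by
    rintro (k | k)
    · rw [FZ_single_inl, hφ, hu]
    · rw [FZ_single_inr, hφv, hv]
      rfl
  refine ⟨Z, φ, hφb, form_ext (φ := (φ : Cn n →ₗ[ℂ] Cn n)) fun p q => ?_⟩
  obtain ⟨w, rfl⟩ := FZ_surjective Z p
  obtain ⟨w', rfl⟩ := FZ_surjective Z q
  have hφF : ∀ w, φ (FZ Z w) = ∑ k, w k • b k := fun w => by
    rw [FZ_eq_sum, map_sum]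
    refine Finset.sum_congr rfl fun k _ => ?_
    rw [← Complex.coe_smul, map_smul, hφb, Complex.coe_smul]
  rw [im_HZ_FZ, LinearEquiv.coe_coe, hφF, hφF, im_form_sum_sum, hb]

/-! ### Integral matrices of maps of lattices -/

/-- Only real linearity is asked, so that the lemma covers both complex linear isomorphisms and
antilinear real structures. -/
theorem exists_matrix_of_mapsTo {Z Z' : Siegel n} {f : Cn n → Cn n} (hf : IsLinearMap ℝ f)
    (hL : ∀ u ∈ LZ Z, f u ∈ LZ Z') :
    ∃ P : Matrix (Fin n ⊕ Fin n) (Fin n ⊕ Fin n) ℤ,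
      ∀ w, f (FZ Z w) = FZ Z' (realMat P *ᵥ w) := by
  have h : ∀ l, ∃ p, FZ Z' (realVec p) = f (FZ Z (Pi.single l 1)) := fun l =>
    (mem_LZ_iff Z' _).1 (hL _ (Submodule.subset_span ⟨l, rfl⟩))
  choose p hp using h
  refine ⟨Matrix.of fun k l => p l k, fun w => ?_⟩
  have h1 : (IsLinearMap.mk' f hf).comp (FZ Z) =
      (FZ Z').comp (realMat (Matrix.of fun k l => p l k)).mulVecLin := by
    refine LinearMap.pi_ext' fun l => LinearMap.ext_ring ?_
    change f (FZ Z (Pi.single l 1)) = FZ Z' (realMat _ *ᵥ Pi.single l 1)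
    rw [← hp, mulVec_single_one]
    rfl
  exact LinearMap.congr_fun h1 w

theorem realMat_injective :
    Function.Injective (realMat : Matrix (Fin n ⊕ Fin n) (Fin n ⊕ Fin n) ℤ → _) :=
  Matrix.map_injective Int.cast_injective

theorem realMat_ext {P P' : Matrix (Fin n ⊕ Fin n) (Fin n ⊕ Fin n) ℤ}
    (h : ∀ w, realMat P *ᵥ w = realMat P' *ᵥ w) : P = P' :=
  realMat_injective (Matrix.ext_of_mulVec_single fun _ => h _)

theorem dotProduct_mulVec_ext {P P' : Matrix (Fin n ⊕ Fin n) (Fin n ⊕ Fin n) ℝ}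
    (h : ∀ w w', w ⬝ᵥ (P *ᵥ w') = w ⬝ᵥ (P' *ᵥ w')) : P = P' := by
  refine Matrix.ext_of_mulVec_single fun i => ?_
  ext j
  simpa using h (Pi.single j 1) (Pi.single i 1)

theorem realMat_J : realMat (J (Fin n) ℤ) = J (Fin n) ℝ := map_J _ _

theorem transpose_mul_J_mul_of_im {Z Z' : Siegel n}
    {P : Matrix (Fin n ⊕ Fin n) (Fin n ⊕ Fin n) ℤ}
    (h : ∀ w w', (HZ Z' (FZ Z' (realMat P *ᵥ w)) (FZ Z' (realMat P *ᵥ w'))).im =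
      (HZ Z (FZ Z w) (FZ Z w')).im) :
    Pᵀ * J (Fin n) ℤ * P = J (Fin n) ℤ := by
  apply realMat_injective
  rw [realMat_mul, realMat_mul, realMat_J, ← neg_inj, realMat, transpose_map]
  refine dotProduct_mulVec_ext fun w w' => ?_
  have := h w w'
  rw [im_HZ_FZ, im_HZ_FZ, dotProduct_mulVec_mulVec, Matrix.mul_neg, Matrix.neg_mul] at this
  exact this

theorem transpose_mul_J_mul_of_im_neg {Z : Siegel n}
    {P : Matrix (Fin n ⊕ Fin n) (Fin n ⊕ Fin n) ℤ}
    (h : ∀ w w', (HZ Z (FZ Z (realMat P *ᵥ w)) (FZ Z (realMat P *ᵥ w'))).im =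
      -(HZ Z (FZ Z w) (FZ Z w')).im) :
    Pᵀ * J (Fin n) ℤ * P = -J (Fin n) ℤ := by
  apply realMat_injective
  have hJ : realMat (-J (Fin n) ℤ) = -J (Fin n) ℝ := by
    rw [← realMat_J]; ext; simp [-map_J]
  rw [realMat_mul, realMat_mul, realMat_J, hJ, ← neg_inj, realMat, transpose_map]
  refine dotProduct_mulVec_ext fun w w' => ?_
  have := h w w'
  rw [im_HZ_FZ, im_HZ_FZ, dotProduct_mulVec_mulVec, Matrix.mul_neg, Matrix.neg_mul,
    ← dotProduct_neg, ← neg_mulVec] at this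
  exact this

/-- By injectivity of `FZ Z`, equality of N-torsion points is congruence mod N of the corresponding
columns. -/
theorem redMod_eq_of_mkQ_eq (hN : N ≠ 0) (Z : Siegel n)
    {P P' : Matrix (Fin n ⊕ Fin n) (Fin n ⊕ Fin n) ℤ}
    (h : ∀ l, (LZ Z).mkQ ((N : ℂ)⁻¹ • FZ Z (realMat P *ᵥ Pi.single l 1)) =
      (LZ Z).mkQ ((N : ℂ)⁻¹ • FZ Z (realMat P' *ᵥ Pi.single l 1))) :
    redMod n N P = redMod n N P' := by
  have hN' : (N : ℂ) ≠ 0 := by exact_mod_cast hN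
  ext k l
  change ((P k l : ℤ) : ZMod N) = ((P' k l : ℤ) : ZMod N)
  rw [ZMod.intCast_eq_intCast_iff_dvd_sub]
  have h1 := h l
  rw [eq_comm, Submodule.mkQ_apply, Submodule.mkQ_apply, Submodule.Quotient.eq, mem_LZ_iff] at h1
  obtain ⟨w, hw⟩ := h1
  have h2 : FZ Z ((N : ℝ) • realVec w) =
      FZ Z (realMat P' *ᵥ Pi.single l 1 - realMat P *ᵥ Pi.single l 1) := by
    rw [map_smul, hw, map_sub, ← Complex.coe_smul, ← smul_sub, smul_smul, Complex.ofReal_natCast,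
      mul_inv_cancel₀ hN', one_smul]
  have h3 := congrFun (FZ_injective Z h2) k
  simp only [Pi.smul_apply, smul_eq_mul, Pi.sub_apply, mulVec_single_one] at h3
  refine ⟨w k, ?_⟩
  have h4 : (N : ℝ) * (w k : ℝ) = (P' k l : ℝ) - (P k l : ℝ) := h3
  exact_mod_cast h4.symm

theorem map_smul_of_real {κ : Cn n →ₗ⋆[ℂ] Cn n} (r : ℝ) (u : Cn n) : κ (r • u) = r • κ u := by
  rw [← Complex.coe_smul, LinearMap.map_smulₛₗ, Complex.conj_ofReal, Complex.coe_smul]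

theorem map_inv_natCast_smul {κ : Cn n →ₗ⋆[ℂ] Cn n} (u : Cn n) :
    κ ((N : ℂ)⁻¹ • u) = (N : ℂ)⁻¹ • κ u := by
  simp [LinearMap.map_smulₛₗ]

/-! ### Existence of the real point -/

theorem Iminus_mulVec_single (l : Fin n ⊕ Fin n) :
    realMat (Iminus n) *ᵥ Pi.single l 1 =
      (Sum.elim (fun _ => -1) (fun _ => 1) l : ℝ) • Pi.single l 1 := by
  rw [mulVec_single_one]
  ext k
  rcases l with l | l <;> rcases k with k | k <;>
    simp [Iminus, Matrix.one_apply, Pi.single_apply, apply_ite]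

theorem exists_gamma_of_kappaMat {P : Matrix (Fin n ⊕ Fin n) (Fin n ⊕ Fin n) ℤ}
    (hJ : Pᵀ * J (Fin n) ℤ * P = -J (Fin n) ℤ) (hred : redMod n N P = redMod n N (Iminus n)) :
    ∃ γ : Gam n N, kappaMat γ.1 = P := by
  have hT : (Iminus n)ᵀ = Iminus n := by simp [Iminus, fromBlocks_transpose]
  have hIJ : Iminus n * J (Fin n) ℤ * Iminus n = -J (Fin n) ℤ := by
    simp [Iminus, J, fromBlocks_multiply, fromBlocks_neg]
  have hmem : (P * Iminus n)ᵀ ∈ symplecticGroup (Fin n) ℤ := by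
    rw [SymplecticGroup.transpose_mem_iff, SymplecticGroup.mem_iff', transpose_mul, hT]
    calc Iminus n * Pᵀ * J (Fin n) ℤ * (P * Iminus n)
        = Iminus n * (Pᵀ * J (Fin n) ℤ * P) * Iminus n := by simp only [Matrix.mul_assoc]
      _ = _ := by rw [hJ, Matrix.mul_neg, Matrix.neg_mul, hIJ, neg_neg]
  have hg : (⟨_, hmem⟩ : SpZ n) ∈ Gam n N := by
    have h1 : redMod n N (P * Iminus n) = 1 := by
      rw [map_mul, hred, ← map_mul, Iminus_mul_self, map_one]
    change ((P * Iminus n)ᵀ).map _ = 1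
    rw [transpose_map, show (P * Iminus n).map _ = 1 from h1, transpose_one]
  refine ⟨⟨_, hg⟩, ?_⟩
  rw [kappaMat, transpose_transpose, Matrix.mul_assoc, Iminus_mul_self, mul_one]

/-- An antilinear involution with integral matrix `ᵗγ I₋` is `κ(γ, Z)`, and `Z` is then a
`γ`-real point. -/
theorem isRealPoint_of_kappaMat {κ : Cn n →ₗ⋆[ℂ] Cn n} (hinv : ∀ u, κ (κ u) = u) {γ : SpZ n}
    {Z : Siegel n} (h : ∀ w, κ (FZ Z w) = FZ Z (realMat (kappaMat γ) *ᵥ w)) :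
    IsRealPoint γ Z ∧ kappaZ γ Z = κ := by
  have hκ : kappaZ γ Z = κ := by
    refine (Pi.basisFun ℂ (Fin n)).ext fun j => ?_
    rw [Pi.basisFun_apply, ← FZ_single_inr Z j, h, FZ_kappaMat, FZ_single_inr]
    change (blkC γ * Z.mat + blkD γ)ᵀ *ᵥ star (Pi.single j 1) = _
    have h1 : (fun i => ((Pi.single (Sum.inr j) 1 : Fin n ⊕ Fin n → ℝ) (Sum.inl i) : ℂ)) = 0 := by
      ext i
      simp
    have h2 : (fun i => ((Pi.single (Sum.inr j) 1 : Fin n ⊕ Fin n → ℝ) (Sum.inr i) : ℂ)) =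
        star (Pi.single j 1) := by
      ext i
      simp [Pi.single_apply, apply_ite]
    rw [h1, h2, mulVec_zero, sub_zero]
  refine ⟨?_, hκ⟩
  -- An involution is surjective, hence so is ᵗ(CZ + D).
  have hd : IsUnit (blkC γ * Z.mat + blkD γ).det := by
    rw [← det_transpose, ← isUnit_iff_isUnit_det, ← mulVec_surjective_iff_isUnit]
    intro u
    refine ⟨star (κ u), ?_⟩
    change kappaZ γ Z (κ u) = u
    rw [hκ, hinv]
  rw [isRealPoint_iff hd]
  refine Matrix.ext_of_mulVec_single fun i => ?_
  -- The vector F_Z(eᵢ) is the i-th column of Z, so evaluating κ there gives the i-th column of the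
  -- real point equation.
  have h1 := h (Pi.single (Sum.inl i) 1)
  have h2 : (fun j => ((Pi.single (Sum.inl i) 1 : Fin n ⊕ Fin n → ℝ) (Sum.inr j) : ℂ)) = 0 := by
    ext j
    simp
  have h3 : (fun j => ((Pi.single (Sum.inl i) 1 : Fin n ⊕ Fin n → ℝ) (Sum.inl j) : ℂ)) =
      Pi.single i 1 := by
    ext j
    simp [Pi.single_apply, apply_ite]
  rw [← hκ, FZ_kappaMat, h2, h3, mulVec_zero, zero_sub, ← neg_mulVec] at h1
  rw [← h1, ← mulVec_mulVec]
  change _ = (blkC γ * Z.mat + blkD γ)ᵀ *ᵥ star (FZ Z _)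
  rw [star_FZ, h2, h3, add_zero]

theorem exists_isRealPoint_isomorphic (hN : N ≠ 0) {A : Quad n} (hA : A.IsRealPPAV N) :
    ∃ (Z : Siegel n) (γ : Gam n N),
      IsRealPoint γ.1 Z ∧ (stdQuad N γ.1 Z).Isomorphic A := by
  obtain ⟨b, hb⟩ := hA.level
  have hbJ : (Matrix.of fun i j => (A.H (b i) (b j)).im) = -J (Fin n) ℝ := by
    have : -J (Fin n) ℝ = fromBlocks 0 1 (-1) 0 := by simp [J, fromBlocks_neg]
    rw [this]
    exact hb.1
  obtain ⟨Z, φ, hφ, hH⟩ := exists_siegel (b := fun i => (b i : Cn n)) hA.hermitian hA.pos hbJ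
  let κ : Cn n →ₗ⋆[ℂ] Cn n :=
    (φ.symm : Cn n →ₗ[ℂ] Cn n).comp (A.κ.comp (φ : Cn n →ₗ[ℂ] Cn n))
  -- This is 𝒜_Z with the pulled back real structure, not yet known to be some κ(γ, Z).
  let A₁ : Quad n :=
    { L := LZ Z
      H := HZ Z
      κ := κ
      lev := fun i => (LZ Z).mkQ ((N : ℂ)⁻¹ • FZ Z (Pi.single i 1)) }
  have hL : φ '' (LZ Z : Set (Cn n)) = A.L := by
    have h1 : (LZ Z).map (φ.restrictScalars ℤ : Cn n →ₗ[ℤ] Cn n) = A.L := by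
      rw [LZ, Submodule.map_span, ← Set.range_comp]
      have h2 := congrArg (Submodule.map A.L.subtype) b.span_eq
      rw [Submodule.map_span, ← Set.range_comp, Submodule.map_top, Submodule.range_subtype] at h2
      rw [← h2]
      congr 2
      ext1 k
      exact hφ k
    rw [← h1]
    rfl
  have hiso : Quad.IsIso A₁ A φ :=
    { map_lattice := hL
      map_form := hH
      map_real := fun u => φ.apply_symm_apply _
      map_level := fun i x hx => by
        rw [hb.2, ← hφ, ← map_smul, Submodule.mkQ_apply, Submodule.mkQ_apply,
          Submodule.Quotient.eq, ← map_sub, ← SetLike.mem_coe, ← hL]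
        exact Set.mem_image_of_mem _ ((Submodule.Quotient.eq _).1 hx) }
  have hA₁ : A₁.IsRealPPAV N := hiso.isRealPPAV hA
  have hκL : ∀ u ∈ LZ Z, κ u ∈ LZ Z := fun u hu => by
    have : κ u ∈ A₁.κ '' (A₁.L : Set (Cn n)) := ⟨u, hu, rfl⟩
    rwa [hA₁.map_lattice] at this
  obtain ⟨P, hP⟩ := exists_matrix_of_mapsTo (Z := Z) (Z' := Z) (f := κ)
    ⟨map_add κ, map_smul_of_real⟩ hκL
  have hPJ : Pᵀ * J (Fin n) ℤ * P = -J (Fin n) ℤ :=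
    transpose_mul_J_mul_of_im_neg fun w w' => by
      rw [← hP, ← hP]
      exact hA₁.compat _ _
  have hred : redMod n N P = redMod n N (Iminus n) := by
    refine redMod_eq_of_mkQ_eq hN Z fun l => ?_
    have hlev := hA₁.level_compat _ (hiso.symm.isLift_map hb)
    have hcoe : ∀ k, ((b.map hiso.symm.latticeEquiv) k : Cn n) = FZ Z (Pi.single k 1) := fun k => by
      rw [Module.Basis.map_apply, Quad.IsIso.coe_latticeEquiv, ← hφ, φ.symm_apply_apply]
    simp only [hcoe, map_inv_natCast_smul] at hlev
    rw [Iminus_mulVec_single, ← hP]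
    rcases l with l | l
    · simpa using hlev.1 l
    · simpa using hlev.2 l
  obtain ⟨γ, hγ⟩ := exists_gamma_of_kappaMat hPJ hred
  obtain ⟨hreal, hκ⟩ := isRealPoint_of_kappaMat (κ := κ) hA₁.invol (γ := γ.1) (Z := Z) (by rwa [hγ])
  have hA₁' : stdQuad N γ.1 Z = A₁ := by rw [stdQuad, hκ]
  exact ⟨Z, γ, hreal, φ, hA₁' ▸ hiso⟩

/-! ### The cohomology class -/

theorem conj_smul_Gam {s : GalCR} (hs : s ≠ 1) (g : Gam n N) : s • g = tauGam n N g := if_neg hs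

/-- Only the pair (conjugation, conjugation) imposes a condition. -/
theorem isCocycle_fcoc {γ : Gam n N} (h : γ * tauGam n N γ = 1) :
    IsCocycle GalCR (Gam n N) (fcoc γ) := by
  intro s t
  by_cases hs : s = 1
  · rw [hs, one_mul, one_smul]
    simp [fcoc]
  by_cases ht : t = 1
  · simp [fcoc, hs, ht]
  have hst : s * t = 1 := by
    have : s⁻¹ = t := galCR_eq_of_ne_one (by simpa using hs) ht
    rw [← this, mul_inv_cancel]
  simp [fcoc, hs, ht, hst, conj_smul_Gam, h]

theorem H1_mk_fcoc_eq {γ γ' p : Gam n N} (h : γ * p = tauGam n N p * γ')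
    (hc : IsCocycle GalCR (Gam n N) (fcoc γ)) (hc' : IsCocycle GalCR (Gam n N) (fcoc γ')) :
    H1.mk (fcoc γ) hc = H1.mk (fcoc γ') hc' := by
  -- Conjugation acts on the witness by τ, and τ(τ(p)) = p, so the relation becomes γ' = τ(p)⁻¹ γ p.
  refine Quotient.sound ⟨tauGam n N p, fun s => ?_⟩
  by_cases hs : s = 1
  · simp [fcoc, hs]
  · simp only [fcoc, if_neg hs, conj_smul_Gam hs, tauGam_tauGam]
    rw [mul_assoc, h, inv_mul_cancel_left]

/-- If `κ(γ, Z)` is an involution then `γ τ(γ) = 1`. -/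
theorem mul_tauGam_eq_one {γ : Gam n N} {Z : Siegel n} (h : IsRealPoint γ.1 Z)
    (hinv : ∀ u, kappaZ γ.1 Z (kappaZ γ.1 Z u) = u) : γ * tauGam n N γ = 1 := by
  have h1 : kappaMat γ.1 * kappaMat γ.1 = 1 := by
    refine realMat_ext fun w => FZ_injective Z ?_
    rw [realMat_mul, ← mulVec_mulVec, ← kappaZ_FZ h, ← kappaZ_FZ h, hinv, realMat_one, one_mulVec]
  have h2 : γ.1.1ᵀ * (tauSp n γ.1).1ᵀ = 1 := by
    have hT : (Iminus n)ᵀ = Iminus n := by simp [Iminus, fromBlocks_transpose]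
    rw [← h1, coe_tauSp, transpose_mul, transpose_mul, hT]
    simp only [kappaMat, Matrix.mul_assoc]
  have h3 : tauSp n γ.1 * γ.1 = 1 := Subtype.ext (by
    have := congrArg transpose h2
    rwa [← transpose_mul, transpose_transpose, transpose_one] at this)
  exact mul_eq_one_comm.1 (Subtype.ext h3 : tauGam n N γ * γ = 1)

theorem exists_gamma_mul_eq (hN : N ≠ 0) {Z Z' : Siegel n} {γ γ' : Gam n N}
    (h : IsRealPoint γ.1 Z) (h' : IsRealPoint γ'.1 Z')
    (hiso : (stdQuad N γ.1 Z).Isomorphic (stdQuad N γ'.1 Z')) :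
    ∃ p : Gam n N, γ * p = tauGam n N p * γ' := by
  obtain ⟨φ, hφ⟩ := hiso
  obtain ⟨P, hP⟩ := exists_matrix_of_mapsTo (Z := Z) (Z' := Z') (f := φ)
    ⟨map_add φ, fun r u => by rw [← Complex.coe_smul, map_smul, Complex.coe_smul]⟩
    (fun u hu => (hφ.map_mem_iff u).2 hu)
  have hPJ : Pᵀ ∈ symplecticGroup (Fin n) ℤ := by
    rw [SymplecticGroup.transpose_mem_iff, SymplecticGroup.mem_iff']
    refine transpose_mul_J_mul_of_im (Z := Z) (Z' := Z') fun w w' => ?_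
    rw [← hP, ← hP]
    exact congrArg Complex.im (hφ.map_form _ _)
  have hred : redMod n N P = 1 := by
    rw [← map_one (redMod n N)]
    refine redMod_eq_of_mkQ_eq hN Z' fun l => ?_
    rw [realMat_one, one_mulVec, ← hP, ← map_smul]
    exact hφ.map_level l _ rfl
  have hmem : (⟨_, hPJ⟩ : SpZ n) ∈ Gam n N := by
    change Pᵀ.map _ = 1
    rw [transpose_map, show P.map _ = 1 from hred, transpose_one]
  have hcomm : P * kappaMat γ.1 = kappaMat γ'.1 * P := by
    refine realMat_ext fun w => FZ_injective Z' ?_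
    rw [realMat_mul, realMat_mul, ← mulVec_mulVec, ← mulVec_mulVec, ← hP, ← kappaZ_FZ h,
      ← kappaZ_FZ h', ← hP]
    exact hφ.map_real _
  refine ⟨⟨_, hmem⟩, Subtype.ext (Subtype.ext ?_)⟩
  change γ.1.1 * Pᵀ = Iminus n * Pᵀ * Iminus n * γ'.1.1
  have hT : (Iminus n)ᵀ = Iminus n := by simp [Iminus, fromBlocks_transpose]
  -- Transposing P ᵗγ I₋ = ᵗγ' I₋ P and multiplying by I₋ on the left turns it into γ ᵗP = τ(ᵗP) γ'.
  have h1 := congrArg (fun M => Iminus n * Mᵀ) hcomm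
  simp only [kappaMat, transpose_mul, transpose_transpose, hT, ← Matrix.mul_assoc,
    Iminus_mul_self, one_mul] at h1
  exact h1

end RealAbVar

end

theorem mainTheorem9 (n N : ℕ) (hN : 3 ≤ N) :
    (∀ A : RealAbVar.Quad n, A.IsRealPPAV N →
      ∃ (Z : RealAbVar.Siegel n) (γ : RealAbVar.Gam n N),
        RealAbVar.IsRealPoint γ.1 Z ∧
        (∀ γ' : RealAbVar.Gam n N, RealAbVar.IsRealPoint γ'.1 Z → γ' = γ) ∧
        (RealAbVar.stdQuad N γ.1 Z).IsRealPPAV N ∧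
        (RealAbVar.stdQuad N γ.1 Z).Isomorphic A) ∧
    (∀ m : ℕ, 1 ≤ m → N = 4 * m →
      ∀ A A' : RealAbVar.Quad n, A.IsRealPPAV N → A'.IsRealPPAV N → A.Isomorphic A' →
      ∀ (Z Z' : RealAbVar.Siegel n) (γ γ' : RealAbVar.Gam n N),
        RealAbVar.IsRealPoint γ.1 Z → RealAbVar.IsRealPoint γ'.1 Z' →
        (RealAbVar.stdQuad N γ.1 Z).Isomorphic A →
        (RealAbVar.stdQuad N γ'.1 Z').Isomorphic A' →
        ∃ (hc : RealAbVar.IsCocycle RealAbVar.GalCR (RealAbVar.Gam n N) (RealAbVar.fcoc γ))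
          (hc' : RealAbVar.IsCocycle RealAbVar.GalCR (RealAbVar.Gam n N) (RealAbVar.fcoc γ')),
          RealAbVar.H1.mk (RealAbVar.fcoc γ) hc = RealAbVar.H1.mk (RealAbVar.fcoc γ') hc') := by
  have hN0 : N ≠ 0 := by omega
  refine ⟨fun A hA => ?_, ?_⟩
  · obtain ⟨Z, γ, hγ, φ, hφ⟩ := RealAbVar.exists_isRealPoint_isomorphic hN0 hA
    exact ⟨Z, γ, hγ, fun γ' hγ' => hγ.unique hN hγ', hφ.isRealPPAV hA, φ, hφ⟩
  · rintro - - - A A' hA hA' ⟨φ, hφ⟩ Z Z' γ γ' hγ hγ' ⟨ψ, hψ⟩ ⟨ψ', hψ'⟩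
    have hc := RealAbVar.isCocycle_fcoc
      (RealAbVar.mul_tauGam_eq_one hγ (hψ.isRealPPAV hA).invol)
    have hc' := RealAbVar.isCocycle_fcoc
      (RealAbVar.mul_tauGam_eq_one hγ' (hψ'.isRealPPAV hA').invol)
    -- The isomorphism used is the composite 𝒜_Z → A → A' → 𝒜_Z'.
    obtain ⟨p, hp⟩ := RealAbVar.exists_gamma_mul_eq hN0 hγ hγ'
      ⟨_, (hψ.trans hφ).trans hψ'.symm⟩
    exact ⟨hc, hc', RealAbVar.H1_mk_fcoc_eq hp hc hc'⟩
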